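/- Model. A variational circuit $U(\theta)$ acts on $n$ qudits of local dimension $q\ge 2$, starting from $|0\rangle^{\otimes n}$. It contains entangling gates, arranged in $d$ layers of gates acting in parallel on disjoint pairs of (arbitrary, distinct) sites, such that every qudit is acted on by at least one entangling gate; the entangling gates are independent random elements of $\mathrm U(q^2)$, each distributed according to a probability measure that is a unitary 2-design. Each entangling gate may be preceded and succeeded by any number of parameterized gates acting on one or both of its two sites, of the form $W_l e^{-iA\theta_j}W_r$ with $A$ Hermitian, $e^{-iA\theta}$ of period $2\pi$ in $\theta$, and $W_l,W_r$ fixed unitaries; the parameters $\theta\in[0,2\pi]^p$ are drawn uniformly. Let $M_0=I,M_1,\dots,M_{q^2-1}\in\mathbb C^{q\times q}$ satisfy $\mathrm{tr}(M_i^\dagger M_j)=q\,\delta_{ij}$, and for $x\in\{0,\dots,q^2-1\}^n$ put $M_x=M_{x_1}\otimes\cdots\otimes M_{x_n}$, let $|x|$ be the number of nonzero entries of $x$, and $$g_x=\mathbb E_V\,\mathbb E_\theta\,\bigl|\langle 0^n|U(\theta)^\dagger M_xU(\theta)|0^n\rangle\bigr|^2 ,$$ where $\mathbb E_V$ averages over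 the entangling gates. The architecture is called $r$-regularly connected if for every nonempty proper subset $R$ of the qudits, any $r$ consecutive layers contain an entangling gate acting between $R$ and its complement (the least such $r$ is the regular connectivity). Claim. For every such circuit with entangling depth $d$ that is $r$-regularly connected, and every $x\ne 0$, $$g_x\le\Bigl(\frac{2q}{q+1}\Bigr)^n\Bigl(\frac{2q}{q^2+1}\Bigr)^{\lfloor d/r\rfloor}q^{-|x|}+(q^n+1)^{-1}.$$ Consequently, there are absolute constants $a,b>0$ (independent of $n,q,r,d,x$ and of the circuit) such that, with $d^*=a\,r\,n$, for every such circuit, every $x\ne0$ and $d>d^*$, $$g_x\le q^{-n}+q^{-b\,(d-d^*)/r-|x|}.$$ -/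

import Mathlib

open MeasureTheory

noncomputable section

namespace HEA

/-! ### The unitary group `U(q²)` and 2-designs -/

/-- Operators on two qudits of local dimension `q`. -/
abbrev TwoQuditOp (q : ℕ) : Type := Matrix (Fin q × Fin q) (Fin q × Fin q) ℂ

/-- The group `U(q²)` of unitaries on two qudits. -/
abbrev U2 (q : ℕ) : Type := Matrix.unitaryGroup (Fin q × Fin q) ℂ

instance instMeasurableSpaceU2 (q : ℕ) : MeasurableSpace (U2 q) := borel (U2 q)

instance instBorelSpaceU2 (q : ℕ) : BorelSpace (U2 q) := ⟨rfl⟩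

instance instCompactSpaceU2 (q : ℕ) : CompactSpace (U2 q) := by
  have hc : IsCompact (Set.univ.pi fun _ : Fin q × Fin q =>
      Set.univ.pi fun _ : Fin q × Fin q => Metric.closedBall (0 : ℂ) 1) :=
    isCompact_univ_pi fun _ => isCompact_univ_pi fun _ => isCompact_closedBall _ _
  have hcl : IsClosed {A : TwoQuditOp q | star A * A = 1 ∧ A * star A = 1} := by
    apply IsClosed.inter
    · exact isClosed_eq (by fun_prop) continuous_const
    · exact isClosed_eq (by fun_prop) continuous_const
  have hK : IsCompact {A : TwoQuditOp q | star A * A = 1 ∧ A * star A = 1} := by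
    refine IsCompact.of_isClosed_subset hc hcl ?_
    intro A hA i _ j _
    rw [mem_closedBall_zero_iff]
    exact entry_norm_bound_of_unitary (U := A) (Unitary.mem_iff.mpr hA) i j
  exact isCompact_iff_compactSpace.mp hK

/-- The normalized Haar measure on `U(q²)`. -/
def haarU2 (q : ℕ) : Measure (U2 q) := Measure.haarMeasure ⊤

/-- A probability measure on `U(q²)` is a (unitary) 2-design if all entries of
`𝔼[U ⊗ U ⊗ Ū ⊗ Ū]` agree with those of the Haar average. -/
structure IsTwoDesign {q : ℕ} (μ : Measure (U2 q)) : Prop where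
  isProbabilityMeasure : IsProbabilityMeasure μ
  moment_eq : ∀ a a' b b' c c' e e' : Fin q × Fin q,
    (∫ U : U2 q, U.1 a a' * U.1 b b' * star (U.1 c c') * star (U.1 e e') ∂μ) =
      ∫ U : U2 q, U.1 a a' * U.1 b b' * star (U.1 c c') * star (U.1 e e') ∂(haarU2 q)

/-! ### Operators on `n` qudits -/

/-- Operators on `n` qudits of local dimension `q`, as matrices in the computational basis. -/
abbrev QuditOp (n q : ℕ) : Type := Matrix (Fin n → Fin q) (Fin n → Fin q) ℂ

/-- The operator on `n` qudits acting as `A` on the (ordered) pair of sites `(i, j)` and as the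
identity on all other sites; used for `i ≠ j`. -/
def embed {n q : ℕ} (i j : Fin n) (A : TwoQuditOp q) : QuditOp n q :=
  Matrix.of fun a b =>
    if ∀ k, k ≠ i → k ≠ j → a k = b k then A (a i, a j) (b i, b j) else 0

/-- `M₀, …, M_{q²-1}` is an orthogonal operator basis: `M₀ = I` and `tr (Mᵢ† Mⱼ) = q δᵢⱼ`. -/
def IsOperatorBasis {q : ℕ} [NeZero q] (M : Fin (q ^ 2) → Matrix (Fin q) (Fin q) ℂ) : Prop :=
  M 0 = 1 ∧ ∀ i j, ((M i).conjTranspose * M j).trace = if i = j then (q : ℂ) else 0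

/-- `M_x = M_{x₁} ⊗ ⋯ ⊗ M_{xₙ}`. -/
def tensorOp {n q : ℕ} (M : Fin (q ^ 2) → Matrix (Fin q) (Fin q) ℂ) (x : Fin n → Fin (q ^ 2)) :
    QuditOp n q :=
  Matrix.of fun a b => ∏ i, M (x i) (a i) (b i)

/-! ### Circuit architectures -/

/-- The architecture of the entangling gates on `n` qudits: `m` entangling gates, listed in time
order, arranged in `d` layers of gates acting in parallel (on disjoint pairs of sites), such that
every qudit is acted on at least once. There is no geometric constraint on the pairs. -/
structure Architecture (n : ℕ) where
  /-- the number of entangling gates -/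
  m : ℕ
  /-- the entangling depth -/
  d : ℕ
  /-- the first site of each gate -/
  fst : Fin m → Fin n
  /-- the second site of each gate -/
  snd : Fin m → Fin n
  fst_ne_snd : ∀ k, fst k ≠ snd k
  /-- the layer of each gate -/
  layer : Fin m → Fin d
  layer_mono : Monotone layer
  layer_disjoint : ∀ k l, k ≠ l → layer k = layer l →
    Disjoint ({fst k, snd k} : Finset (Fin n)) {fst l, snd l}
  covers : ∀ i, ∃ k, i = fst k ∨ i = snd k

/-- The `k`-th gate acts between the set of sites `R` and its complement. -/
def Architecture.Crosses {n : ℕ} (C : Architecture n) (k : Fin C.m) (R : Finset (Fin n)) : Prop :=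
  (C.fst k ∈ R ∧ C.snd k ∉ R) ∨ (C.fst k ∉ R ∧ C.snd k ∈ R)

/-- `r`-regular connectivity: for every nonempty proper subset `R` of the qudits, any `r`
consecutive layers contain a gate acting between `R` and its complement. This property is monotone
in `r`; the least such `r` is the regular connectivity of the architecture. -/
def Architecture.IsRegularlyConnected {n : ℕ} (C : Architecture n) (r : ℕ) : Prop :=
  ∀ t : ℕ, t + r ≤ C.d → ∀ R : Finset (Fin n), R.Nonempty → R ≠ Finset.univ →
    ∃ k : Fin C.m, t ≤ (C.layer k : ℕ) ∧ (C.layer k : ℕ) < t + r ∧ C.Crosses k R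

/-! ### Variational circuits -/

/-- A parameterized gate `W_l e^{-iAθ} W_r` supported on a pair of sites (`A = A₁ ⊗ I` and so on
gives gates on a single site), with `A` Hermitian, `e^{-iAθ}` of period `2π` in `θ`, and `θ` the
parameter with index `param` among `p` parameters. -/
structure ParamGate (q p : ℕ) where
  A : TwoQuditOp q
  isHermitian : A.IsHermitian
  periodic : NormedSpace.exp ((-(2 * (Real.pi : ℂ) * Complex.I)) • A) = 1
  Wl : U2 q
  Wr : U2 q
  param : Fin p

/-- The matrix of a parameterized gate at the parameter values `θ`. -/
def ParamGate.toOp {q p : ℕ} (G : ParamGate q p) (θ : Fin p → ℝ) : TwoQuditOp q :=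
  G.Wl.1 * NormedSpace.exp ((-((θ G.param : ℂ) * Complex.I)) • G.A) * G.Wr.1

/-- The product of a list of parameterized gates, the head of the list acting first. -/
def paramProd {q p : ℕ} (L : List (ParamGate q p)) (θ : Fin p → ℝ) : TwoQuditOp q :=
  (L.map fun G => G.toOp θ).reverse.prod

/-- A variational circuit with `p` parameters: each entangling gate of the architecture is preceded
and succeeded by any number of parameterized gates acting on (one or both of) its sites. -/
structure VarCircuit (n q p : ℕ) extends Architecture n where
  /-- parameterized gates preceding each entangling gate -/
  pre : Fin m → List (ParamGate q p)
  /-- parameterized gates succeeding each entangling gate -/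
  post : Fin m → List (ParamGate q p)

variable {n q p : ℕ}

/-- The `k`-th entangling gate `V k` together with the parameterized gates attached to it. -/
def VarCircuit.block (C : VarCircuit n q p) (V : Fin C.m → U2 q) (θ : Fin p → ℝ) (k : Fin C.m) :
    QuditOp n q :=
  embed (C.fst k) (C.snd k) (paramProd (C.post k) θ * (V k).1 * paramProd (C.pre k) θ)

/-- The circuit `U(θ)` for the realization `V` of the entangling gates; the first block acts
first, so it is the rightmost factor. -/
def VarCircuit.U (C : VarCircuit n q p) (V : Fin C.m → U2 q) (θ : Fin p → ℝ) : QuditOp n q :=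
  (List.ofFn fun k => C.block V θ k).reverse.prod

/-- `⟨0ⁿ| U(θ)† M U(θ) |0ⁿ⟩`. -/
def VarCircuit.expVal [NeZero q] (C : VarCircuit n q p) (V : Fin C.m → U2 q) (θ : Fin p → ℝ)
    (M : QuditOp n q) : ℂ :=
  ((C.U V θ).conjTranspose * M * C.U V θ) (fun _ => 0) (fun _ => 0)

/-- `g_x = 𝔼_V 𝔼_θ |⟨0ⁿ| U(θ)† M_x U(θ) |0ⁿ⟩|²`, where the entangling gates are independent with
laws `μ k` and `θ` is uniform on `[0, 2π]^p`. -/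
def VarCircuit.g [NeZero q] (C : VarCircuit n q p) (μ : Fin C.m → Measure (U2 q))
    (M : Fin (q ^ 2) → Matrix (Fin q) (Fin q) ℂ) (x : Fin n → Fin (q ^ 2)) : ℝ :=
  ∫ V, (⨍ θ in Set.Icc (0 : Fin p → ℝ) (fun _ => 2 * Real.pi),
    ‖C.expVal V θ (tensorOp M x)‖ ^ 2) ∂(Measure.pi μ)

end HEA

end

/-! The quantity $|\langle U^\dagger M_xU\rangle|^2$ is linear in $U\otimes U\otimes\bar
U\otimes\bar U$, so for fixed $\theta$ independence lets each gate be averaged separately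
(`meanMatrix_pi_prod`). The average over a 2-design is the Haar average, which absorbs the unitaries
on its left by invariance; those on its right do not change the contractions with identity and swap,
which are all that the average sees. Hence the parameterized gates drop out (`IsTwoDesign.twirl`),
and the bound is uniform in $\theta$.

The averaged gate projects onto the span of identity and swap, by the two-copy commutant theorem
`exists_eq_pairing_of_invariant`. Every site meets a gate, so the initial state may be replaced by
$(q(q+1))^{-n}$ times the sum over all $2^n$ identity/swap configurations. A gate fixes a
configuration that agrees on its two sites; otherwise it sets both sites to a common value, with
weight $\kappa=q/(q^2+1)$ for each value (`ActsAsTwirl.dotProduct_pairing_eq_backward`). Paired with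
$M_x$, a swap gives $q$, and an identity gives $q^2$ off the support of $x$ and $0$ on it.

The final configurations split into three classes. All-identity gives $0$ because $x\ne0$. A
nonconstant one gives at most $q^{2n-|x|}$, and its weight loses a factor $2\kappa$ in each window
of $r$ layers, since some gate there crosses the cut between its two values
(`backward_nonconst_le`). All-swap gives $q^n$; its total weight is controlled by a conserved
quantity and the symmetry exchanging identity and swap (`sum_backward_true_le`), which yields
exactly $(q^n+1)^{-1}$. The exponential form is then elementary (`rpow_bound`). -/

noncomputable section

namespace HEA

open scoped Kronecker Matrix


/-! ### Two-copy tensors and their invariants -/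

section TwoCopy

variable {ι : Type*} [Fintype ι] [DecidableEq ι]

/-- `W ⊗ W ⊗ W̄ ⊗ W̄`. -/
def twoCopy (W : Matrix ι ι ℂ) : Matrix ((ι × ι) × (ι × ι)) ((ι × ι) × (ι × ι)) ℂ :=
  (W ⊗ₖ W) ⊗ₖ (W.map (starRingEnd ℂ) ⊗ₖ W.map (starRingEnd ℂ))

omit [Fintype ι] [DecidableEq ι] in
theorem twoCopy_apply (W : Matrix ι ι ℂ) (a b c e a' b' c' e' : ι) :
    twoCopy W ((a, b), (c, e)) ((a', b'), (c', e')) =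
      (W a a' * W b b') * (starRingEnd ℂ (W c c') * starRingEnd ℂ (W e e')) := rfl

omit [DecidableEq ι] in
theorem twoCopy_mul (A B : Matrix ι ι ℂ) : twoCopy (A * B) = twoCopy A * twoCopy B := by
  simp only [twoCopy, Matrix.map_mul, Matrix.mul_kronecker_mul]

omit [Fintype ι] in
theorem twoCopy_one : twoCopy (1 : Matrix ι ι ℂ) = 1 := by
  simp [twoCopy, Matrix.map_one]

/-- The identity (`false`) or the swap (`true`) of two copies. -/
def copyPerm (s : Bool) (u : ι × ι) : ι × ι := if s then u.swap else u

/-- The identity (`false`) or swap (`true`) operator on two copies, as a tensor. -/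
def pairing (s : Bool) (p : (ι × ι) × (ι × ι)) : ℂ := if p.2 = copyPerm s p.1 then 1 else 0

/-- The contraction of a two-copy tensor with `pairing s`. -/
def contract (s : Bool) (X : (ι × ι) × (ι × ι) → ℂ) : ℂ := ∑ u, X (u, copyPerm s u)

omit [DecidableEq ι] in
theorem contract_add (s : Bool) (X Y : (ι × ι) × (ι × ι) → ℂ) :
    contract s (X + Y) = contract s X + contract s Y := by
  simp [contract, Finset.sum_add_distrib]

omit [DecidableEq ι] in
theorem contract_smul (s : Bool) (c : ℂ) (X : (ι × ι) × (ι × ι) → ℂ) :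
    contract s (c • X) = c * contract s X := by
  simp [contract, Finset.mul_sum]

theorem contract_pairing_self (s : Bool) :
    contract s (pairing s : (ι × ι) × (ι × ι) → ℂ) = (Fintype.card ι : ℂ) ^ 2 := by
  simp [contract, pairing, sq]

theorem contract_pairing_of_ne {s t : Bool} (h : s ≠ t) :
    contract s (pairing t : (ι × ι) × (ι × ι) → ℂ) = Fintype.card ι := by
  have hst : ∀ x y : ι, (x = y ∧ y = x) ↔ y = x := fun x y =>
    ⟨fun h => h.2, fun h => ⟨h.symm, h⟩⟩
  have hts : ∀ x y : ι, (y = x ∧ x = y) ↔ y = x := fun x y => ⟨fun h => h.1, fun h => ⟨h, h.symm⟩⟩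
  cases s <;> cases t
  · exact absurd rfl h
  · simp only [contract, pairing, copyPerm, Fintype.sum_prod_type, Prod.swap, Prod.mk.injEq,
      Bool.false_eq_true, if_false, if_true, hst, Finset.sum_ite_eq', Finset.mem_univ]
    simp
  · simp only [contract, pairing, copyPerm, Fintype.sum_prod_type, Prod.swap, Prod.mk.injEq,
      Bool.false_eq_true, if_false, if_true, hts, Finset.sum_ite_eq', Finset.mem_univ]
    simp
  · exact absurd rfl h

theorem unitary_sum {W : Matrix ι ι ℂ} (hW : W ∈ Matrix.unitaryGroup ι ℂ) (c a : ι) :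
    ∑ k, W k a * starRingEnd ℂ (W k c) = if c = a then 1 else 0 := by
  have h := congrFun (congrFun (Matrix.mem_unitaryGroup_iff'.mp hW) c) a
  simp only [Matrix.mul_apply, Matrix.star_apply, Matrix.one_apply] at h
  rw [← h]
  exact Finset.sum_congr rfl fun k _ => mul_comm _ _

/-- Identity and swap commute with $W\otimes W$, so pairing with either one is conserved by
conjugation; orthonormality of the columns of $W$ makes each pairing a fixed vector of the
transposed action. -/
theorem contract_twoCopy_mulVec {W : Matrix ι ι ℂ} (hW : W ∈ Matrix.unitaryGroup ι ℂ) (s : Bool)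
    (X : (ι × ι) × (ι × ι) → ℂ) : contract s (twoCopy W *ᵥ X) = contract s X := by
  have key : ∀ p : (ι × ι) × (ι × ι),
      ∑ u : ι × ι, twoCopy W (u, copyPerm s u) p = if p.2 = copyPerm s p.1 then 1 else 0 := by
    rintro ⟨⟨a, b⟩, ⟨c, e⟩⟩
    cases s
    · simp only [copyPerm, Fintype.sum_prod_type, Bool.false_eq_true, if_false, twoCopy_apply]
      have : ∀ x y, W x a * W y b * ((starRingEnd ℂ) (W x c) * (starRingEnd ℂ) (W y e)) =
          (W x a * starRingEnd ℂ (W x c)) * (W y b * starRingEnd ℂ (W y e)) := fun _ _ => by ring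
      simp_rw [this, ← Finset.mul_sum, ← Finset.sum_mul, unitary_sum hW]
      by_cases h1 : c = a <;> by_cases h2 : e = b <;> simp [h1, h2]
    · simp only [copyPerm, Fintype.sum_prod_type, if_true, Prod.swap, twoCopy_apply]
      have : ∀ x y, W x a * W y b * ((starRingEnd ℂ) (W y c) * (starRingEnd ℂ) (W x e)) =
          (W x a * starRingEnd ℂ (W x e)) * (W y b * starRingEnd ℂ (W y c)) := fun _ _ => by ring
      simp_rw [this, ← Finset.mul_sum, ← Finset.sum_mul, unitary_sum hW]
      by_cases h1 : c = b <;> by_cases h2 : e = a <;> simp [h1, h2]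
  simp only [contract, Matrix.mulVec, dotProduct]
  rw [Finset.sum_comm]
  simp_rw [← Finset.sum_mul, key]
  rw [Fintype.sum_prod_type]
  simp

theorem diagonal_mem_unitaryGroup {z : ι → ℂ} (hz : ∀ k, z k * starRingEnd ℂ (z k) = 1) :
    Matrix.diagonal z ∈ Matrix.unitaryGroup ι ℂ := by
  rw [Matrix.mem_unitaryGroup_iff, Matrix.star_eq_conjTranspose, Matrix.diagonal_conjTranspose,
    Matrix.diagonal_mul_diagonal, ← Matrix.diagonal_one]
  congr 1
  exact funext hz

theorem twoCopy_diagonal_mulVec (z : ι → ℂ) (Y : (ι × ι) × (ι × ι) → ℂ) (a b c e : ι) :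
    (twoCopy (Matrix.diagonal z) *ᵥ Y) ((a, b), (c, e)) =
      z a * z b * (starRingEnd ℂ (z c) * starRingEnd ℂ (z e)) * Y ((a, b), (c, e)) := by
  have : (Matrix.diagonal z).map (starRingEnd ℂ) = Matrix.diagonal fun k => starRingEnd ℂ (z k) :=
    Matrix.diagonal_map (map_zero _)
  simp only [twoCopy, this, Matrix.diagonal_kronecker_diagonal, Matrix.mulVec_diagonal]

theorem permutation_mem_unitaryGroup (σ : Equiv.Perm ι) :
    σ.toPEquiv.toMatrix ∈ Matrix.unitaryGroup ι ℂ := by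
  rw [Matrix.mem_unitaryGroup_iff]
  ext i j
  simp [Matrix.mul_apply, PEquiv.toMatrix_apply, Matrix.one_apply, eq_comm]

theorem twoCopy_permutation_mulVec (σ : Equiv.Perm ι) (Y : (ι × ι) × (ι × ι) → ℂ) (a b c e : ι) :
    (twoCopy (σ.toPEquiv.toMatrix : Matrix ι ι ℂ) *ᵥ Y) ((a, b), (c, e)) =
      Y ((σ a, σ b), (σ c, σ e)) := by
  simp [Matrix.mulVec, dotProduct, Fintype.sum_prod_type, twoCopy_apply, PEquiv.toMatrix_apply,
    ite_mul, mul_ite, apply_ite (starRingEnd ℂ)]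

/-- A real reflection mixing two basis vectors. -/
theorem exists_unitary_row {i j : ι} (hij : i ≠ j) :
    ∃ W ∈ Matrix.unitaryGroup ι ℂ,
      ∀ k, W i k = (if i = k then (7 / 25 : ℂ) else 0) + (if j = k then (-24 / 25 : ℂ) else 0) := by
  let v : ι → ℂ := Pi.single i (3 / 5) + Pi.single j (4 / 5)
  have hv : v ⬝ᵥ v = 1 := by
    simp [v, hij, hij.symm]
    norm_num
  have hs : star v = v := by
    ext k
    simp only [v, Pi.star_apply, Pi.add_apply, Pi.single_apply]
    split_ifs <;> simp
  let P := Matrix.vecMulVec v v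
  have hP : P * P = P := by
    simp only [P, Matrix.vecMulVec_mul_vecMulVec, hv, one_smul]
  have hPs : star P = P := by
    rw [Matrix.star_eq_conjTranspose, Matrix.conjTranspose_vecMulVec, hs]
  refine ⟨1 - (2 : ℂ) • P, ?_, fun k => ?_⟩
  · rw [Matrix.mem_unitaryGroup_iff, star_sub, star_one, star_smul, hPs]
    have h2 : star (2 : ℂ) = 2 := by simp
    rw [h2]
    simp only [sub_mul, mul_sub, one_mul, mul_one, smul_mul_assoc, mul_smul_comm, hP]
    module
  · simp only [P, v, Matrix.sub_apply, Matrix.smul_apply, Matrix.vecMulVec_apply, Pi.add_apply,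
      Pi.single_apply, Matrix.one_apply, smul_eq_mul, if_true, if_neg hij]
    by_cases h1 : i = k
    · subst h1
      simp [hij, hij.symm]
      norm_num
    · by_cases h2 : j = k
      · subst h2
        simp [hij, hij.symm]
        norm_num
      · simp [h1, h2, Ne.symm h1, Ne.symm h2]

omit [Fintype ι] in
theorem exists_perm_pair {a b a' b' : ι} (h : a ≠ b) (h' : a' ≠ b') :
    ∃ σ : Equiv.Perm ι, σ a = a' ∧ σ b = b' := by
  refine ⟨(Equiv.swap a a').trans (Equiv.swap (Equiv.swap a a' b) b'), ?_, ?_⟩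
  · have h1 : Equiv.swap a a' b ≠ a' := fun hb => h ((Equiv.swap a a').injective (by simp [hb]))
    simp [Equiv.swap_apply_of_ne_of_ne h1.symm h']
  · simp

/-- The commutant of `U ⊗ U` is spanned by the identity and the swap. -/
theorem exists_eq_pairing_of_invariant [Nontrivial ι] {Y : (ι × ι) × (ι × ι) → ℂ}
    (hY : ∀ U ∈ Matrix.unitaryGroup ι ℂ, twoCopy U *ᵥ Y = Y) :
    ∃ α β : ℂ, Y = α • pairing false + β • pairing true := by
  -- Invariance under the diagonal unitary with phase $i$ at the single index $x$. A sign $-1$ would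
  -- not suffice: it cannot exclude entries such as $((a,a),(c,c))$.
  have hphase : ∀ a b c e x : ι, Y ((a, b), (c, e)) ≠ 0 →
      (if a = x then Complex.I else 1) * (if b = x then Complex.I else 1) *
        ((if c = x then -Complex.I else 1) * (if e = x then -Complex.I else 1)) = 1 := by
    intro a b c e x h0
    have h := congrFun (hY _ (diagonal_mem_unitaryGroup
      (z := fun k => if k = x then Complex.I else 1) (fun k => by split_ifs <;> simp)))
      ((a, b), (c, e))
    rw [twoCopy_diagonal_mulVec] at h
    simpa [apply_ite (starRingEnd ℂ)] using mul_right_cancel₀ h0 (h.trans (one_mul _).symm)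
  have hI1 : Complex.I ≠ 1 := fun h => by simpa using congrArg Complex.re h
  have hI2 : -Complex.I ≠ 1 := fun h => by simpa using congrArg Complex.re h
  have hsupp : ∀ a b c e : ι, Y ((a, b), (c, e)) ≠ 0 → (c = a ∧ e = b) ∨ (c = b ∧ e = a) := by
    intro a b c e h0
    by_cases hca : c = a
    · subst hca
      left
      refine ⟨rfl, ?_⟩
      by_contra heb
      have h := hphase _ _ _ _ b h0
      by_cases hcb : c = b <;> simp [heb, hcb, hI1] at h
    · by_cases hcb : c = b
      · subst hcb
        right
        refine ⟨rfl, ?_⟩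
        by_contra heb
        have h := hphase _ _ _ _ a h0
        simp [hca, heb, hI1] at h
      · have h := hphase _ _ _ _ c h0
        by_cases hec : e = c
        · simp [Ne.symm hca, Ne.symm hcb, hec] at h
          norm_num at h
        · simp [Ne.symm hca, Ne.symm hcb, hec, hI2] at h
  -- Permutation invariance leaves three unknowns on the support: the value for $a\ne b$ paired by
  -- the identity, the one paired by the swap, and the one with all indices equal.
  have hperm : ∀ (σ : Equiv.Perm ι) (a b c e : ι),
      Y ((σ a, σ b), (σ c, σ e)) = Y ((a, b), (c, e)) := by
    intro σ a b c e
    rw [← twoCopy_permutation_mulVec σ Y, hY _ (permutation_mem_unitaryGroup σ)]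
  obtain ⟨i, j, hij⟩ := exists_pair_ne ι
  have hα : ∀ a b : ι, a ≠ b → Y ((a, b), (a, b)) = Y ((i, j), (i, j)) := by
    intro a b hab
    obtain ⟨σ, rfl, rfl⟩ := exists_perm_pair hij hab
    exact hperm σ _ _ _ _
  have hβ : ∀ a b : ι, a ≠ b → Y ((a, b), (b, a)) = Y ((i, j), (j, i)) := by
    intro a b hab
    obtain ⟨σ, rfl, rfl⟩ := exists_perm_pair hij hab
    exact hperm σ _ _ _ _
  have hdiag : ∀ a : ι, Y ((a, a), (a, a)) = Y ((i, i), (i, i)) := by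
    intro a
    simpa using hperm (Equiv.swap i a) i i i i
  -- The third unknown is the sum of the other two. With $p,s$ the nonzero entries of row $i$ of the
  -- reflection, invariance reads $\kappa=(p^4+s^4)\kappa+2p^2s^2(\alpha+\beta)$, and $p^2+s^2=1$.
  -- The final constant is $-1/(2p^2s^2)$ for $p=7/25$, $s=-24/25$.
  have hκ : Y ((i, i), (i, i)) = Y ((i, j), (i, j)) + Y ((i, j), (j, i)) := by
    obtain ⟨W, hW, hrow⟩ := exists_unitary_row hij
    have h := congrFun (hY W hW) ((i, i), (i, i))
    have hz : ∀ a b c e : ι, ¬((c = a ∧ e = b) ∨ (c = b ∧ e = a)) → Y ((a, b), (c, e)) = 0 :=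
      fun a b c e hn => by_contra fun h0 => hn (hsupp a b c e h0)
    simp only [Matrix.mulVec, dotProduct, Fintype.sum_prod_type, twoCopy_apply, hrow] at h
    simp only [map_add, apply_ite (starRingEnd ℂ), map_zero, add_mul, mul_add, ite_mul, mul_ite,
      zero_mul, mul_zero, Finset.sum_add_distrib, Finset.sum_ite_eq, Finset.mem_univ, if_true,
      map_div₀, map_neg, map_ofNat] at h
    simp only [hz i i i j (by simp [hij.symm]), hz i i j i (by simp [hij.symm]),
      hz i j i i (by simp [hij]), hz j i i i (by simp [hij]),
      hz j j j i (by simp [hij]), hz j j i j (by simp [hij]),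
      hz j i j j (by simp [hij.symm]), hz i j j j (by simp [hij.symm]),
      hz i i j j (by simp [hij.symm]), hz j j i i (by simp [hij]), hdiag j,
      hα j i hij.symm, hβ j i hij.symm] at h
    linear_combination (-390625 / 56448 : ℂ) * h
  refine ⟨Y ((i, j), (i, j)), Y ((i, j), (j, i)), ?_⟩
  ext ⟨⟨a, b⟩, ⟨c, e⟩⟩
  simp only [Pi.add_apply, Pi.smul_apply, smul_eq_mul, pairing, copyPerm, Prod.swap, if_true,
    Bool.false_eq_true, if_false, Prod.mk.injEq]
  by_cases h1 : c = a ∧ e = b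
  · obtain ⟨rfl, rfl⟩ := h1
    by_cases hce : c = e
    · subst hce
      simp [hdiag, hκ]
    · simp [hce, hα _ _ hce]
  · by_cases h2 : c = b ∧ e = a
    · obtain ⟨rfl, rfl⟩ := h2
      have hne : e ≠ c := fun h => h1 ⟨h.symm, h⟩
      simp [hne.symm, hβ _ _ hne]
    · rw [if_neg h1, if_neg h2]
      by_contra h0
      rcases hsupp a b c e (by simpa using h0) with h | h
      · exact h1 h
      · exact h2 h

/-- The coefficients of the twirl of a two-copy tensor of dimension `D` with contractions `u`
(identity) and `v` (swap): `twirlCoeff D u v` for the identity and `twirlCoeff D v u` for the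
swap. -/
def twirlCoeff (D u v : ℂ) : ℂ := (D * u - v) / (D * (D ^ 2 - 1))

/-- An invariant two-copy tensor is determined by its two contractions. -/
theorem eq_twirl_of_invariant [Nontrivial ι] {Y : (ι × ι) × (ι × ι) → ℂ}
    (hY : ∀ U ∈ Matrix.unitaryGroup ι ℂ, twoCopy U *ᵥ Y = Y) :
    Y = twirlCoeff (Fintype.card ι) (contract false Y) (contract true Y) • pairing false +
      twirlCoeff (Fintype.card ι) (contract true Y) (contract false Y) • pairing true := by
  -- The contractions of the two pairings form the Gram matrix with $D^2$ on the diagonal and $D$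
  -- off it; `twirlCoeff` is its inverse, with determinant $D^2(D^2-1)\ne0$.
  obtain ⟨α, β, rfl⟩ := exists_eq_pairing_of_invariant hY
  have hD : 1 < Fintype.card ι := Fintype.one_lt_card
  have h0 : (Fintype.card ι : ℂ) ≠ 0 := by
    exact_mod_cast (by omega : Fintype.card ι ≠ 0)
  have h1 : (Fintype.card ι : ℂ) ^ 2 - 1 ≠ 0 := by
    rw [sub_ne_zero]
    exact_mod_cast (Nat.one_lt_pow two_ne_zero hD).ne'
  simp only [contract_add, contract_smul, contract_pairing_self,
    contract_pairing_of_ne (show false ≠ true by decide),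
    contract_pairing_of_ne (show true ≠ false by decide), twirlCoeff]
  congr 2 <;> field_simp <;> ring

end TwoCopy

/-! ### Entrywise expectations of random matrices -/

section Mean

variable {X : Type*} [MeasurableSpace X] {s t u : Type*}

/-- The entrywise expectation of a random matrix. -/
def meanMatrix (μ : Measure X) (F : X → Matrix s t ℂ) : Matrix s t ℂ :=
  Matrix.of fun a b => ∫ x, F x a b ∂μ

variable [TopologicalSpace X] [CompactSpace X] [OpensMeasurableSpace X]

theorem integrable_of_continuous_of_compactSpace {E : Type*} [NormedAddCommGroup E]
    [SecondCountableTopology E] (μ : Measure X) [IsFiniteMeasure μ] {f : X → E}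
    (hf : Continuous f) : Integrable f μ := by
  borelize E
  obtain ⟨C, hC⟩ := (isCompact_range hf).isBounded.exists_norm_le
  exact Integrable.of_bound hf.measurable.aestronglyMeasurable C
    (Filter.Eventually.of_forall fun x => hC _ ⟨x, rfl⟩)

theorem meanMatrix_mulVec [Fintype t] (μ : Measure X) [IsFiniteMeasure μ] {F : X → Matrix s t ℂ}
    (hF : Continuous F) (v : t → ℂ) (a : s) :
    (meanMatrix μ F *ᵥ v) a = ∫ x, (F x *ᵥ v) a ∂μ := by
  have h : ∀ b ∈ Finset.univ, Integrable (fun x => F x a b * v b) μ := fun b _ =>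
    integrable_of_continuous_of_compactSpace μ ((hF.matrix_elem a b).mul continuous_const)
  exact ((integral_finsetSum _ h).trans
    (Finset.sum_congr rfl fun b _ => integral_mul_const _ _)).symm

theorem meanMatrix_mul_mul {r : Type*} [Fintype s] [Fintype t] (μ : Measure X) [IsFiniteMeasure μ]
    {F : X → Matrix s t ℂ} (hF : Continuous F) (A : Matrix r s ℂ) (B : Matrix t u ℂ) :
    meanMatrix μ (fun x => A * F x * B) = A * meanMatrix μ F * B := by
  have h1 : meanMatrix μ (fun x => A * F x) = A * meanMatrix μ F := by
    ext a b
    have h : ∀ c ∈ Finset.univ, Integrable (fun x => A a c * F x c b) μ := fun c _ =>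
      integrable_of_continuous_of_compactSpace μ (continuous_const.mul (hF.matrix_elem c b))
    exact (integral_finsetSum _ h).trans
      (Finset.sum_congr rfl fun c _ => integral_const_mul _ _)
  rw [← h1]
  ext a b
  have h : ∀ c ∈ Finset.univ, Integrable (fun x => (A * F x) a c * B c b) μ := fun c _ =>
    integrable_of_continuous_of_compactSpace μ
      (((continuous_const.matrix_mul hF).matrix_elem a c).mul continuous_const)
  exact (integral_finsetSum _ h).trans
    (Finset.sum_congr rfl fun c _ => integral_mul_const _ _)

/-- The expectation of a product of independent random matrices. -/
theorem meanMatrix_pi_prod [SecondCountableTopology X] [Fintype s] [DecidableEq s] :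
    ∀ (m : ℕ) (μ : Fin m → Measure X) [∀ k, IsProbabilityMeasure (μ k)]
      (F : Fin m → X → Matrix s s ℂ), (∀ k, Continuous (F k)) →
      meanMatrix (Measure.pi μ) (fun V => (List.ofFn fun k => F k (V k)).reverse.prod) =
        (List.ofFn fun k => meanMatrix (μ k) (F k)).reverse.prod := by
  intro m
  induction m with
  | zero =>
    intro μ _ F _
    ext a b
    simp [meanMatrix]
  | succ m ih =>
    intro μ _ F hF
    have hcont : Continuous fun V : Fin m → X =>
        (List.ofFn fun k => F k.succ (V k)).reverse.prod := by
      simp only [List.ofFn_eq_map, ← List.map_reverse]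
      exact continuous_list_prod _ fun k _ => (hF k.succ).comp (continuous_apply k)
    simp only [List.ofFn_succ, List.reverse_cons, List.prod_append, List.prod_cons, List.prod_nil,
      mul_one]
    rw [← ih (fun k => μ k.succ) (fun k => F k.succ) fun k => hF k.succ]
    ext a b
    simp only [meanMatrix, Matrix.mul_apply, Matrix.of_apply]
    -- Coordinate $0$ is split off the product measure. It is the rightmost factor, so each summand
    -- becomes a product of functions of separate variables.
    rw [← ((measurePreserving_piFinSuccAbove μ 0).symm).integral_comp']
    simp_rw [MeasurableEquiv.piFinSuccAbove_symm_apply, Fin.insertNthEquiv,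
      Fin.insertNth_zero, Equiv.coe_fn_mk, Fin.cons_succ, Fin.zero_succAbove, cast_eq,
      Fin.cons_zero]
    rw [integral_finsetSum]
    · refine Finset.sum_congr rfl fun c _ => ?_
      simp_rw [mul_comm _ (F 0 _ c b)]
      rw [mul_comm, ← integral_prod_mul]
    · intro c _
      exact integrable_of_continuous_of_compactSpace _
        (((hcont.comp continuous_snd).matrix_elem a c).mul
          (((hF 0).comp continuous_fst).matrix_elem c b))

end Mean

theorem continuous_twoCopy {X ι : Type*} [TopologicalSpace X] {F : X → Matrix ι ι ℂ}
    (hF : Continuous F) : Continuous fun x => twoCopy (F x) := by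
  refine continuous_matrix fun a b => ?_
  simp only [twoCopy, Matrix.kroneckerMap_apply, Matrix.map_apply]
  have := fun i j => hF.matrix_elem i j
  have := fun i j => Complex.continuous_conj.comp (this i j)
  fun_prop

/-! ### The twirl over a 2-design -/

section Twirl

variable {q : ℕ}

instance : IsProbabilityMeasure (haarU2 q) := ⟨by
  exact Measure.haarMeasure_self (K₀ := (⊤ : TopologicalSpace.PositiveCompacts (U2 q)))⟩

instance : (haarU2 q).IsMulLeftInvariant := by
  unfold haarU2
  infer_instance

theorem continuous_U2_val : Continuous fun V : U2 q => V.1 := continuous_subtype_val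

theorem IsTwoDesign.meanMatrix_eq {μ : Measure (U2 q)} (hμ : IsTwoDesign μ) :
    meanMatrix μ (fun V => twoCopy V.1) = meanMatrix (haarU2 q) (fun V => twoCopy V.1) := by
  ext ⟨⟨a, b⟩, ⟨c, e⟩⟩ ⟨⟨a', b'⟩, ⟨c', e'⟩⟩
  simp only [meanMatrix, Matrix.of_apply, twoCopy_apply, ← mul_assoc]
  exact hμ.moment_eq a a' b b' c c' e e'

/-- Left invariance of Haar measure: multiplying by $U$ only relabels the integration variable. -/
theorem twoCopy_mul_meanMatrix_haar (U : U2 q) :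
    twoCopy U.1 * meanMatrix (haarU2 q) (fun V => twoCopy V.1) =
      meanMatrix (haarU2 q) (fun V => twoCopy V.1) := by
  have h := meanMatrix_mul_mul (haarU2 q) (continuous_twoCopy continuous_U2_val) (twoCopy U.1)
    (1 : Matrix _ ((((Fin q × Fin q) × (Fin q × Fin q))) × ((Fin q × Fin q) × (Fin q × Fin q))) ℂ)
  simp only [mul_one] at h
  rw [← h]
  simp only [← twoCopy_mul]
  ext a b
  exact integral_mul_left_eq_self (μ := haarU2 q) (fun V : U2 q => twoCopy V.1 a b) U

/-- True for every probability law, as each realization conserves the contraction. Together with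
invariance this determines the averaged tensor. -/
theorem contract_meanMatrix_twoCopy_mulVec (μ : Measure (U2 q)) [IsProbabilityMeasure μ] (s : Bool)
    (Y : ((Fin q × Fin q) × (Fin q × Fin q)) × ((Fin q × Fin q) × (Fin q × Fin q)) → ℂ) :
    contract s (meanMatrix μ (fun V => twoCopy V.1) *ᵥ Y) = contract s Y := by
  have hc := continuous_twoCopy (continuous_U2_val (q := q))
  simp only [contract, meanMatrix_mulVec μ hc]
  rw [← integral_finsetSum _ fun u _ => integrable_of_continuous_of_compactSpace μ ?_]
  · have : ∀ V : U2 q, ∑ u, (twoCopy V.1 *ᵥ Y) (u, copyPerm s u) = ∑ u, Y (u, copyPerm s u) :=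
      fun V => contract_twoCopy_mulVec V.2 s Y
    simp [this]
  · simp only [Matrix.mulVec, dotProduct]
    exact continuous_finsetSum _ fun d _ => (hc.matrix_elem _ _).mul continuous_const

/-- Second moments of a 2-design element multiplied by fixed unitaries. -/
theorem IsTwoDesign.twirl (hq : 2 ≤ q) {μ : Measure (U2 q)} (hμ : IsTwoDesign μ)
    {A B : TwoQuditOp q} (hA : A ∈ Matrix.unitaryGroup (Fin q × Fin q) ℂ)
    (hB : B ∈ Matrix.unitaryGroup (Fin q × Fin q) ℂ)
    (Y : ((Fin q × Fin q) × (Fin q × Fin q)) × ((Fin q × Fin q) × (Fin q × Fin q)) → ℂ) :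
    meanMatrix μ (fun V => twoCopy (A * V.1 * B)) *ᵥ Y =
      twirlCoeff ((q : ℂ) ^ 2) (contract false Y) (contract true Y) • pairing false +
        twirlCoeff ((q : ℂ) ^ 2) (contract true Y) (contract false Y) • pairing true := by
  have := hμ.isProbabilityMeasure
  have : Nontrivial (Fin q) := Fin.nontrivial_iff_two_le.mpr hq
  simp only [twoCopy_mul]
  rw [meanMatrix_mul_mul μ (continuous_twoCopy continuous_U2_val), hμ.meanMatrix_eq,
    twoCopy_mul_meanMatrix_haar ⟨A, hA⟩, ← Matrix.mulVec_mulVec]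
  have h := eq_twirl_of_invariant
    (Y := meanMatrix (haarU2 q) (fun V => twoCopy V.1) *ᵥ (twoCopy B *ᵥ Y)) fun U hU => by
      rw [Matrix.mulVec_mulVec, twoCopy_mul_meanMatrix_haar ⟨U, hU⟩]
  rw [h]
  simp only [contract_meanMatrix_twoCopy_mulVec, contract_twoCopy_mulVec hB, Fintype.card_prod,
    Fintype.card_fin, Nat.cast_mul, sq]

end Twirl

/-! ### Local twirls acting on product tensors -/

section Local

variable {n q : ℕ}

/-- The two-copy index at site `i`. -/
def siteIndex (p : ((Fin n → Fin q) × (Fin n → Fin q)) × ((Fin n → Fin q) × (Fin n → Fin q)))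
    (i : Fin n) : (Fin q × Fin q) × (Fin q × Fin q) :=
  ((p.1.1 i, p.1.2 i), (p.2.1 i, p.2.2 i))

/-- The tensor product of local two-copy tensors. -/
def prodTensor (τ : Fin n → (Fin q × Fin q) × (Fin q × Fin q) → ℂ)
    (p : ((Fin n → Fin q) × (Fin n → Fin q)) × ((Fin n → Fin q) × (Fin n → Fin q))) : ℂ :=
  ∏ i, τ i (siteIndex p i)

/-- The tensor product of two local two-copy tensors. -/
def pairTensor (f g : (Fin q × Fin q) × (Fin q × Fin q) → ℂ)
    (p : ((Fin q × Fin q) × (Fin q × Fin q)) × ((Fin q × Fin q) × (Fin q × Fin q))) : ℂ :=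
  f ((p.1.1.1, p.1.2.1), (p.2.1.1, p.2.2.1)) * g ((p.1.1.2, p.1.2.2), (p.2.1.2, p.2.2.2))

/-- Identity and swap on a pair of sites factor over the sites; hence a twirl keeps product tensors
within sums of product tensors. -/
theorem pairTensor_pairing (s : Bool) : pairTensor (q := q) (pairing s) (pairing s) = pairing s := by
  ext ⟨⟨⟨a, a'⟩, ⟨b, b'⟩⟩, ⟨⟨c, c'⟩, ⟨e, e'⟩⟩⟩
  simp only [pairTensor, pairing, ← ite_and, mul_ite, mul_one, mul_zero]
  congr 1
  cases s <;> simp [copyPerm] <;> tauto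

theorem contract_pairTensor (s : Bool) (f g : (Fin q × Fin q) × (Fin q × Fin q) → ℂ) :
    contract s (pairTensor f g) = contract s f * contract s g := by
  simp only [contract, Fintype.sum_prod_type, Finset.sum_mul_sum]
  cases s <;> simp only [pairTensor, copyPerm, Prod.swap, if_true, Bool.false_eq_true, if_false]

/-- Replace the entries at the sites `i` and `j`. -/
def setPair (i j : Fin n) (a : Fin n → Fin q) (u : Fin q × Fin q) : Fin n → Fin q :=
  Function.update (Function.update a i u.1) j u.2

theorem sum_embed_mul {i j : Fin n} (hij : i ≠ j) (W : TwoQuditOp q) (a : Fin n → Fin q)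
    (f : (Fin n → Fin q) → ℂ) :
    ∑ b, embed i j W a b * f b = ∑ u, W (a i, a j) u * f (setPair i j a u) := by
  simp only [embed, Matrix.of_apply, ite_mul, zero_mul]
  rw [← Finset.sum_filter]
  refine Finset.sum_nbij' (fun b => (b i, b j)) (fun u => setPair i j a u) (by simp) ?_ ?_ ?_ ?_
  · intro u _
    simp only [Finset.mem_filter, Finset.mem_univ, true_and, setPair]
    intro k hi hj
    simp [Function.update_of_ne hi, Function.update_of_ne hj]
  · intro b hb
    simp only [Finset.mem_filter, Finset.mem_univ, true_and] at hb
    ext1 k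
    by_cases hj : k = j
    · subst hj
      simp [setPair]
    · by_cases hi : k = i
      · subst hi
        simp [setPair, hij]
      · simp [setPair, hi, hj, hb k hi hj]
  · intro u _
    simp [setPair, hij]
  · intro b hb
    simp only [Finset.mem_filter, Finset.mem_univ, true_and] at hb
    congr 2
    ext1 k
    by_cases hj : k = j
    · subst hj
      simp [setPair]
    · by_cases hi : k = i
      · subst hi
        simp [setPair, hij]
      · simp [setPair, hi, hj, hb k hi hj]

theorem map_embed (i j : Fin n) (W : TwoQuditOp q) :
    (embed i j W).map (starRingEnd ℂ) = embed i j (W.map (starRingEnd ℂ)) := by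
  ext a b
  simp [embed, apply_ite (starRingEnd ℂ)]

theorem continuous_embed {X : Type*} [TopologicalSpace X] (i j : Fin n) {F : X → TwoQuditOp q}
    (hF : Continuous F) : Continuous fun x => embed (n := n) i j (F x) := by
  refine continuous_matrix fun a b => ?_
  simp only [embed, Matrix.of_apply]
  split_ifs
  · exact hF.matrix_elem _ _
  · exact continuous_const

/-- Freezing all other sites reduces a gate on $n$ qudits to the two-site tensor acting on slices.
-/
theorem twoCopy_embed_mulVec {i j : Fin n} (hij : i ≠ j) (W : TwoQuditOp q)
    (Φ : ((Fin n → Fin q) × (Fin n → Fin q)) × ((Fin n → Fin q) × (Fin n → Fin q)) → ℂ)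
    (a b c e : Fin n → Fin q) :
    (twoCopy (embed i j W) *ᵥ Φ) ((a, b), (c, e)) =
      (twoCopy W *ᵥ fun p => Φ ((setPair i j a p.1.1, setPair i j b p.1.2),
        (setPair i j c p.2.1, setPair i j e p.2.2)))
        (((a i, a j), (b i, b j)), ((c i, c j), (e i, e j))) := by
  simp only [Matrix.mulVec, dotProduct, twoCopy, map_embed]
  generalize W.map (starRingEnd ℂ) = W'
  rw [Fintype.sum_prod_type, Fintype.sum_prod_type, Fintype.sum_prod_type, Fintype.sum_prod_type]
  simp only [Matrix.kroneckerMap_apply, mul_assoc, ← Finset.mul_sum, sum_embed_mul hij,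
    Fintype.sum_prod_type (α₁ := (Fin n → Fin q)), 
    Fintype.sum_prod_type (α₁ := (Fin q × Fin q))]

theorem prod_eq_pair_mul {K : Type*} [CommMonoid K] {i j : Fin n} (hij : i ≠ j) (f : Fin n → K) :
    ∏ k, f k = f i * f j * ∏ k ∈ (Finset.univ.erase i).erase j, f k := by
  rw [mul_assoc, Finset.mul_prod_erase _ f (by simp [hij.symm]),
    Finset.mul_prod_erase _ f (Finset.mem_univ i)]

/-- The averaged block on the sites `i` and `j` acts on a product tensor. -/
theorem IsTwoDesign.meanMatrix_embed_mulVec (hq : 2 ≤ q) {μ : Measure (U2 q)} (hμ : IsTwoDesign μ)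
    {A B : TwoQuditOp q} (hA : A ∈ Matrix.unitaryGroup (Fin q × Fin q) ℂ)
    (hB : B ∈ Matrix.unitaryGroup (Fin q × Fin q) ℂ) {i j : Fin n} (hij : i ≠ j)
    (τ : Fin n → (Fin q × Fin q) × (Fin q × Fin q) → ℂ) :
    meanMatrix μ (fun V => twoCopy (embed i j (A * V.1 * B))) *ᵥ prodTensor τ =
      twirlCoeff ((q : ℂ) ^ 2) (contract false (τ i) * contract false (τ j))
          (contract true (τ i) * contract true (τ j)) •
        prodTensor (Function.update (Function.update τ i (pairing false)) j (pairing false)) +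
      twirlCoeff ((q : ℂ) ^ 2) (contract true (τ i) * contract true (τ j))
          (contract false (τ i) * contract false (τ j)) •
        prodTensor (Function.update (Function.update τ i (pairing true)) j (pairing true)) := by
  have := hμ.isProbabilityMeasure
  have hW : Continuous fun V : U2 q => A * V.1 * B :=
    (continuous_const.matrix_mul continuous_U2_val).matrix_mul continuous_const
  ext ⟨⟨a, b⟩, ⟨c, e⟩⟩
  set R : ℂ := ∏ k ∈ (Finset.univ.erase i).erase j, τ k (siteIndex ((a, b), (c, e)) k) with hR
  -- On a product tensor the untouched sites contribute only the scalar $R$.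
  have hslice : (fun p : ((Fin q × Fin q) × (Fin q × Fin q)) × ((Fin q × Fin q) × (Fin q × Fin q)) =>
      prodTensor τ ((setPair i j a p.1.1, setPair i j b p.1.2),
        (setPair i j c p.2.1, setPair i j e p.2.2))) = R • pairTensor (τ i) (τ j) := by
    ext p
    rw [prodTensor, prod_eq_pair_mul hij, Pi.smul_apply, smul_eq_mul, mul_comm]
    congr 1
    · refine Finset.prod_congr rfl fun k hk => ?_
      simp only [Finset.mem_erase, Finset.mem_univ, and_true] at hk
      simp [siteIndex, setPair, Function.update_of_ne hk.1, Function.update_of_ne hk.2]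
    · simp [siteIndex, setPair, pairTensor, hij]
  have hout : ∀ s : Bool,
      prodTensor (Function.update (Function.update τ i (pairing s)) j (pairing s))
        ((a, b), (c, e)) = R * pairing s (((a i, a j), (b i, b j)), ((c i, c j), (e i, e j))) := by
    intro s
    rw [← pairTensor_pairing, prodTensor, prod_eq_pair_mul hij, mul_comm]
    congr 1
    · refine Finset.prod_congr rfl fun k hk => ?_
      simp only [Finset.mem_erase, Finset.mem_univ, and_true] at hk
      simp [Function.update_of_ne hk.1, Function.update_of_ne hk.2]
    · simp [siteIndex, pairTensor, hij]
  rw [meanMatrix_mulVec μ (continuous_twoCopy (continuous_embed i j hW))]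
  simp only [twoCopy_embed_mulVec hij, hslice]
  rw [← meanMatrix_mulVec μ (continuous_twoCopy hW), Matrix.mulVec_smul, hμ.twirl hq hA hB]
  simp only [Pi.add_apply, Pi.smul_apply, smul_eq_mul, hout, contract_pairTensor]
  ring

end Local

/-! ### The domain-wall recursion -/

section Backward

variable {n : ℕ}

/-- Set a configuration to `s` at the two sites of a gate. -/
def setBoth (γ : Fin n → Bool) (g : Fin n × Fin n) (s : Bool) : Fin n → Bool :=
  Function.update (Function.update γ g.1 s) g.2 s

/-- The expectation of the observable `h` of identity/swap configurations, as a function of the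
configuration before a list of gates: a gate acting on unequal sites sets both of them to a common
value, each value with weight `κ`. -/
def backward (κ : ℝ) : List (Fin n × Fin n) → ((Fin n → Bool) → ℝ) → (Fin n → Bool) → ℝ
  | [], h, γ => h γ
  | g :: G, h, γ => if γ g.1 = γ g.2 then backward κ G h γ else
      κ * (backward κ G h (setBoth γ g false) + backward κ G h (setBoth γ g true))

theorem backward_append (κ : ℝ) (G G' : List (Fin n × Fin n)) (h : (Fin n → Bool) → ℝ) :
    backward κ (G ++ G') h = backward κ G (backward κ G' h) := by
  induction G with
  | nil => rfl
  | cons g G ih =>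
    ext γ
    simp only [List.cons_append, backward, ih]

theorem backward_mono {κ : ℝ} (hκ : 0 ≤ κ) (G : List (Fin n × Fin n))
    {h h' : (Fin n → Bool) → ℝ} (hh : ∀ γ, h γ ≤ h' γ) (γ : Fin n → Bool) :
    backward κ G h γ ≤ backward κ G h' γ := by
  induction G generalizing γ with
  | nil => exact hh γ
  | cons g G ih =>
    simp only [backward]
    split_ifs
    · exact ih γ
    · exact mul_le_mul_of_nonneg_left (add_le_add (ih _) (ih _)) hκ

theorem backward_linear (κ : ℝ) (G : List (Fin n × Fin n)) (a b : ℝ)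
    (h h' : (Fin n → Bool) → ℝ) (γ : Fin n → Bool) :
    backward κ G (fun γ => a * h γ + b * h' γ) γ =
      a * backward κ G h γ + b * backward κ G h' γ := by
  induction G generalizing γ with
  | nil => rfl
  | cons g G ih =>
    simp only [backward, ih]
    split_ifs
    · rfl
    · ring

theorem backward_const (κ : ℝ) (G : List (Fin n × Fin n)) (h : (Fin n → Bool) → ℝ) (s : Bool) :
    backward κ G h (fun _ => s) = h fun _ => s := by
  induction G with
  | nil => rfl
  | cons g G ih => simpa [backward] using ih

/-- Both outcomes of a gate carry the same weight, so the recursion commutes with complementing all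
bits. -/
theorem backward_not (κ : ℝ) (G : List (Fin n × Fin n)) (h : (Fin n → Bool) → ℝ)
    (γ : Fin n → Bool) :
    backward κ G (fun γ => h fun i => !γ i) γ = backward κ G h fun i => !γ i := by
  induction G generalizing γ with
  | nil => rfl
  | cons g G ih =>
    have hs : ∀ s, (fun i => !setBoth γ g s i) = setBoth (fun i => !γ i) g (!s) := by
      intro s
      ext i
      simp only [setBoth, Function.update_apply]
      split_ifs <;> rfl
    simp only [backward, ih, hs, Bool.not_false, Bool.not_true, Bool.not_inj_iff]
    split_ifs
    · rfl
    · rw [add_comm]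

theorem backward_le {κ c : ℝ} (hκ : 0 ≤ κ) (hκ' : 2 * κ ≤ 1) (hc : 0 ≤ c)
    (G : List (Fin n × Fin n)) {h : (Fin n → Bool) → ℝ} (hh : ∀ γ, h γ ≤ c) (γ : Fin n → Bool) :
    backward κ G h γ ≤ c := by
  induction G generalizing γ with
  | nil => exact hh γ
  | cons g G ih =>
    simp only [backward]
    split_ifs
    · exact ih γ
    · calc _ ≤ κ * (c + c) := mul_le_mul_of_nonneg_left (add_le_add (ih _) (ih _)) hκ
        _ = 2 * κ * c := by ring
        _ ≤ c := mul_le_of_le_one_left hc hκ'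

/-- Gates on equal sites leave `γ` unchanged, so the given unequal pair remains available until some
gate meets unequal values; that gate costs $2\kappa$, and later gates cost at most $1$. -/
theorem backward_le_of_crosses {κ c : ℝ} (hκ : 0 ≤ κ) (hκ' : 2 * κ ≤ 1) (hc : 0 ≤ c)
    (G : List (Fin n × Fin n)) {h : (Fin n → Bool) → ℝ} (hh : ∀ γ, h γ ≤ c) {γ : Fin n → Bool}
    (hG : ∃ g ∈ G, γ g.1 ≠ γ g.2) : backward κ G h γ ≤ 2 * κ * c := by
  induction G with
  | nil => simp at hG
  | cons g G ih =>
    simp only [backward]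
    split_ifs with hg
    · refine ih ?_
      obtain ⟨g', hg', hne⟩ := hG
      rcases List.mem_cons.mp hg' with rfl | hmem
      · exact absurd hg hne
      · exact ⟨g', hmem, hne⟩
    · calc _ ≤ κ * (c + c) := mul_le_mul_of_nonneg_left (add_le_add
            (backward_le hκ hκ' hc G hh _) (backward_le hκ hκ' hc G hh _)) hκ
        _ = 2 * κ * c := by ring

/-- The indicator function of the configurations that are not constant. -/
def nonconst (γ : Fin n → Bool) : ℝ :=
  if γ = (fun _ => false) ∨ γ = (fun _ => true) then 0 else 1

theorem filter_append_filter_of_sorted {β : Type*} (ℓ : β → ℕ) (T : ℕ) {ks : List β}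
    (hks : ks.Pairwise fun a b => ℓ a ≤ ℓ b) :
    ks.filter (fun k => ℓ k < T) ++ ks.filter (fun k => T ≤ ℓ k) = ks := by
  induction ks with
  | nil => rfl
  | cons a ks ih =>
    rw [List.pairwise_cons] at hks
    by_cases ha : ℓ a < T
    · simp [ha, not_le.mpr ha, ih hks.2]
    · have h1 : ∀ b ∈ ks, T ≤ ℓ b := fun b hb => (not_lt.mp ha).trans (hks.1 b hb)
      have h2 : ks.filter (fun k => ℓ k < T) = [] :=
        List.filter_eq_nil_iff.mpr fun b hb => by simpa using h1 b hb
      have h3 : ks.filter (fun k => T ≤ ℓ k) = ks :=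
        List.filter_eq_self.mpr fun b hb => by simpa using h1 b hb
      simp [ha, not_lt.mp ha, h2, h3]

/-- Every window of `r` layers in which each cut is crossed contributes a factor `2 κ` to the weight
of the nonconstant configurations. -/
theorem backward_nonconst_le {β : Type*} (g : β → Fin n × Fin n) (ℓ : β → ℕ) (r : ℕ) {κ : ℝ}
    (hκ : 0 ≤ κ) (hκ' : 2 * κ ≤ 1) (w t : ℕ) (ks : List β)
    (hks : ks.Pairwise fun a b => ℓ a ≤ ℓ b)
    (hw : ∀ j < w, ∀ γ : Fin n → Bool, γ ≠ (fun _ => false) → γ ≠ (fun _ => true) →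
      ∃ k ∈ ks, t + j * r ≤ ℓ k ∧ ℓ k < t + j * r + r ∧ γ (g k).1 ≠ γ (g k).2)
    (γ : Fin n → Bool) : backward κ (ks.map g) nonconst γ ≤ (2 * κ) ^ w := by
  have hnc : ∀ γ : Fin n → Bool, nonconst γ ≤ 1 := fun γ => by
    unfold nonconst
    split_ifs <;> norm_num
  induction w generalizing t ks γ with
  | zero => exact (backward_le hκ hκ' zero_le_one _ hnc γ).trans_eq (pow_zero _).symm
  | succ w ih =>
    have h2κ : 0 ≤ 2 * κ := by positivity
    by_cases hγ : γ = (fun _ => false) ∨ γ = (fun _ => true)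
    · have : backward κ (ks.map g) nonconst γ = 0 := by
        rcases hγ with rfl | rfl <;> rw [backward_const] <;> simp [nonconst]
      rw [this]
      exact pow_nonneg h2κ _
    · rw [not_or] at hγ
      have hsplit := filter_append_filter_of_sorted ℓ (t + r) hks
      -- The gates before layer $t+r$ give one factor $2\kappa$; the induction hypothesis bounds the
      -- later ones uniformly over the configurations they receive.
      rw [← hsplit, List.map_append, backward_append, pow_succ']
      refine backward_le_of_crosses hκ hκ' (pow_nonneg h2κ _) _ (fun γ' => ?_) ?_
      · refine ih (t + r) _ (hks.sublist List.filter_sublist) (fun j hj δ h0 h1 => ?_) γ'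
        obtain ⟨k, hk, hlo, hhi, hne⟩ := hw (j + 1) (by omega) δ h0 h1
        rw [Nat.add_mul, one_mul] at hlo hhi
        refine ⟨k, List.mem_filter.mpr ⟨hk, by simp; omega⟩, by omega, by omega, hne⟩
      · obtain ⟨k, hk, hlo, hhi, hne⟩ := hw 0 (by omega) γ hγ.1 hγ.2
        exact ⟨g k, List.mem_map.mpr ⟨k, List.mem_filter.mpr ⟨hk, by simp; omega⟩, rfl⟩, hne⟩

/-- The squared trace of an identity/swap configuration is conserved. -/
theorem backward_prod_eq {q : ℝ} (G : List (Fin n × Fin n)) (hG : ∀ g ∈ G, g.1 ≠ g.2)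
    (γ : Fin n → Bool) :
    backward (q / (q ^ 2 + 1)) G (fun γ => ∏ i, if γ i then q else q ^ 2) γ =
      ∏ i, if γ i then q else q ^ 2 := by
  induction G generalizing γ with
  | nil => rfl
  | cons g G ih =>
    have hg := hG g (List.mem_cons_self ..)
    replace ih := ih fun g' h => hG g' (List.mem_cons_of_mem _ h)
    simp only [backward, ih]
    split_ifs with h
    · rfl
    · have hset : ∀ s, (∏ i, if setBoth γ g s i then q else q ^ 2) =
          (if s then q else q ^ 2) ^ 2 *
            ∏ i ∈ (Finset.univ.erase g.1).erase g.2, if γ i then q else q ^ 2 := by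
        intro s
        rw [prod_eq_pair_mul hg, sq (ite _ _ _)]
        congr 1
        · simp [setBoth, hg]
        · refine Finset.prod_congr rfl fun k hk => ?_
          simp only [Finset.mem_erase, Finset.mem_univ, and_true] at hk
          simp [setBoth, Function.update_of_ne hk.1, Function.update_of_ne hk.2]
      rw [hset, hset, prod_eq_pair_mul hg]
      have hpos : q ^ 2 + 1 ≠ 0 := by positivity
      have hp : (if γ g.1 then q else q ^ 2) * (if γ g.2 then q else q ^ 2) = q * q ^ 2 := by
        cases h1 : γ g.1 <;> cases h2 : γ g.2 <;> simp_all [mul_comm]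
      rw [hp]
      simp only [Bool.false_eq_true, if_false, if_true]
      field_simp

/-- The total weight of the configurations that become constantly `true` (swap). -/
theorem sum_backward_true_le {q : ℝ} (hq : 0 < q) (hn : 0 < n) (G : List (Fin n × Fin n))
    (hG : ∀ g ∈ G, g.1 ≠ g.2) :
    (q ^ (2 * n) + q ^ n) * ∑ γ : Fin n → Bool,
        backward (q / (q ^ 2 + 1)) G (fun γ => if γ = fun _ => true then 1 else 0) γ ≤
      (q * (q + 1)) ^ n := by
  set κ := q / (q ^ 2 + 1)
  have hκ : 0 ≤ κ := by positivity
  have hflip : ∑ γ : Fin n → Bool, backward κ G (fun γ => if γ = fun _ => false then 1 else 0) γ =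
      ∑ γ : Fin n → Bool, backward κ G (fun γ => if γ = fun _ => true then 1 else 0) γ := by
    have : (fun γ : Fin n → Bool => if γ = fun _ => false then (1 : ℝ) else 0) =
        fun γ => (fun γ => if γ = fun _ => true then (1 : ℝ) else 0) fun i => !γ i := by
      ext γ
      simp [funext_iff]
    rw [this]
    simp only [backward_not κ G (fun γ => if γ = fun _ => true then (1 : ℝ) else 0)]
    exact Equiv.sum_comp (Equiv.piCongrRight fun _ => Equiv.boolNot)
      (fun γ => backward κ G (fun γ => if γ = fun _ => true then (1 : ℝ) else 0) γ)
  have hsum : ∑ γ : Fin n → Bool, ∏ i, (if γ i then q else q ^ 2) = (q * (q + 1)) ^ n := by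
    have h := Finset.prod_univ_sum (fun _ : Fin n => (Finset.univ : Finset Bool))
      (fun _ s => if s then q else q ^ 2)
    rw [Fintype.piFinset_univ] at h
    rw [← h]
    simp
    ring
  -- The conserved product equals $q^{2n}$ on all-identity and $q^n$ on all-swap and is nonnegative
  -- elsewhere. By the flip symmetry the two constant outcomes have the same total weight.
  have hpt : ∀ γ : Fin n → Bool,
      q ^ (2 * n) * (if γ = fun _ => false then 1 else 0) +
        q ^ n * (if γ = fun _ => true then 1 else 0) ≤ ∏ i, if γ i then q else q ^ 2 := by
    intro γ
    by_cases h0 : γ = fun _ => false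
    · have h1 : γ ≠ fun _ => true := fun h => by
        have := congrFun (h0.symm.trans h) ⟨0, hn⟩
        simp at this
      simp [h0, pow_mul, show ¬ ((fun _ : Fin n => false) = fun _ => true) from h0 ▸ h1]
    · by_cases h1 : γ = fun _ => true
      · simp [h1, show ¬ ((fun _ : Fin n => true) = fun _ => false) from h1 ▸ h0]
      · simp only [h0, h1, if_false, mul_zero, add_zero]
        exact Finset.prod_nonneg fun i _ => by split_ifs <;> positivity
  calc _ = ∑ γ : Fin n → Bool, backward κ G (fun γ =>
        q ^ (2 * n) * (if γ = fun _ => false then 1 else 0) +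
          q ^ n * (if γ = fun _ => true then 1 else 0)) γ := by
        simp only [backward_linear, Finset.sum_add_distrib, ← Finset.mul_sum, hflip]
        ring
    _ ≤ ∑ γ : Fin n → Bool, ∏ i, (if γ i then q else q ^ 2) :=
        Finset.sum_le_sum fun γ _ => (backward_mono hκ G hpt γ).trans_eq (backward_prod_eq G hG γ)
    _ = _ := hsum

/-- The total weight of the observable which vanishes on identities at the sites in `S`. -/
theorem sum_backward_le {q B : ℝ} (hq : 1 ≤ q) (hn : 0 < n) (G : List (Fin n × Fin n))
    (hG : ∀ g ∈ G, g.1 ≠ g.2)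
    (hB : ∀ γ, backward (q / (q ^ 2 + 1)) G nonconst γ ≤ B) {S : Finset (Fin n)}
    (hS : S.Nonempty) :
    ((q * (q + 1))⁻¹) ^ n * ∑ γ : Fin n → Bool, backward (q / (q ^ 2 + 1)) G
        (fun γ => ∏ i, if γ i then q else if i ∈ S then 0 else q ^ 2) γ ≤
      (2 * q / (q + 1)) ^ n * B * (q ^ S.card)⁻¹ + (q ^ n + 1)⁻¹ := by
  set κ := q / (q ^ 2 + 1)
  have hq0 : 0 < q := by linarith
  have hκ : 0 ≤ κ := by positivity
  -- All-identity vanishes since `S` is nonempty. For a nonconstant configuration each site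
  -- contributes at most $q^2$, and at most $q=q^2q^{-1}$ when it lies in `S`.
  have hpt : ∀ γ : Fin n → Bool, (∏ i, if γ i then q else if i ∈ S then 0 else q ^ 2) ≤
      (q ^ (2 * n) * (q ^ S.card)⁻¹) * nonconst γ +
        q ^ n * (if γ = fun _ => true then 1 else 0) := by
    intro γ
    by_cases h1 : γ = fun _ => true
    · simp [h1, nonconst]
    · by_cases h0 : γ = fun _ => false
      · obtain ⟨i, hi⟩ := hS
        have : (∏ i, if γ i then q else if i ∈ S then 0 else q ^ 2) = 0 :=
          Finset.prod_eq_zero (Finset.mem_univ i) (by simp [h0, hi])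
        rw [this]
        simp [h0, nonconst]
        positivity
      · simp only [nonconst, h0, h1, or_self, if_false, mul_one, mul_zero, add_zero]
        calc _ ≤ ∏ i, q ^ 2 * (if i ∈ S then q⁻¹ else 1) := by
              refine Finset.prod_le_prod (fun i _ => by split_ifs <;> positivity) fun i _ => ?_
              have : q ^ 2 * q⁻¹ = q := by field_simp
              split_ifs
              · exact this.ge
              · nlinarith
              · rw [this]; exact hq0.le
              · simp
          _ = _ := by
              rw [Finset.prod_mul_distrib, Finset.prod_ite_mem]
              simp [pow_mul]
  have hsum : ∑ γ : Fin n → Bool, backward κ G nonconst γ ≤ 2 ^ n * B := by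
    calc _ ≤ ∑ _γ : Fin n → Bool, B := Finset.sum_le_sum fun γ _ => hB γ
      _ = _ := by simp
  have htrue := sum_backward_true_le hq0 hn G hG
  set Z := ∑ γ : Fin n → Bool, backward κ G (fun γ => if γ = fun _ => true then 1 else 0) γ
  have hc : 0 < (q * (q + 1)) ^ n := by positivity
  have h1 : ((q * (q + 1))⁻¹) ^ n * (q ^ n * Z) ≤ (q ^ n + 1)⁻¹ := by
    rw [inv_pow, inv_mul_le_iff₀ hc, le_mul_inv_iff₀ (by positivity)]
    calc _ = (q ^ (2 * n) + q ^ n) * Z := by ring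
      _ ≤ _ := htrue
  have h2 : ((q * (q + 1))⁻¹) ^ n * (q ^ (2 * n) * (q ^ S.card)⁻¹ * (2 ^ n * B)) =
      (2 * q / (q + 1)) ^ n * B * (q ^ S.card)⁻¹ := by
    have : (2 * q / (q + 1)) ^ n = ((q * (q + 1))⁻¹) ^ n * (q ^ (2 * n) * 2 ^ n) := by
      rw [pow_mul, ← mul_pow, ← mul_pow]
      congr 1
      field_simp
    rw [this]
    ring
  calc _ ≤ ((q * (q + 1))⁻¹) ^ n * ∑ γ : Fin n → Bool, backward κ G (fun γ =>
        (q ^ (2 * n) * (q ^ S.card)⁻¹) * nonconst γ +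
          q ^ n * (if γ = fun _ => true then 1 else 0)) γ :=
        mul_le_mul_of_nonneg_left
          (Finset.sum_le_sum fun γ _ => backward_mono hκ G hpt γ) (by positivity)
    _ = ((q * (q + 1))⁻¹) ^ n * ((q ^ (2 * n) * (q ^ S.card)⁻¹) *
          (∑ γ : Fin n → Bool, backward κ G nonconst γ)) +
        ((q * (q + 1))⁻¹) ^ n * (q ^ n * Z) := by
        simp only [backward_linear, Finset.sum_add_distrib, ← Finset.mul_sum, Z]
        ring
    _ ≤ _ := by
        rw [← h2]
        gcongr

end Backward

/-! ### Sequences of averaged blocks -/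

section Sequence

variable {n q : ℕ}

theorem prodTensor_dotProduct (ρ τ : Fin n → (Fin q × Fin q) × (Fin q × Fin q) → ℂ) :
    prodTensor ρ ⬝ᵥ prodTensor τ = ∏ i, ρ i ⬝ᵥ τ i := by
  let e : (Fin n → (Fin q × Fin q) × (Fin q × Fin q)) ≃
      ((Fin n → Fin q) × (Fin n → Fin q)) × ((Fin n → Fin q) × (Fin n → Fin q)) :=
    { toFun := fun f => ((fun i => (f i).1.1, fun i => (f i).1.2),
        (fun i => (f i).2.1, fun i => (f i).2.2))
      invFun := fun p i => siteIndex p i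
      left_inv := fun _ => rfl
      right_inv := fun _ => rfl }
  have h := Finset.prod_univ_sum
    (fun _ : Fin n => (Finset.univ : Finset ((Fin q × Fin q) × (Fin q × Fin q))))
    (fun i p => ρ i p * τ i p)
  rw [Fintype.piFinset_univ] at h
  simp only [dotProduct]
  rw [h, ← e.sum_comp]
  simp only [prodTensor, ← Finset.prod_mul_distrib]
  rfl

theorem dotProduct_pairing (s : Bool) (f : (Fin q × Fin q) × (Fin q × Fin q) → ℂ) :
    f ⬝ᵥ pairing s = contract s f := by
  simp only [dotProduct, pairing, contract, mul_ite, mul_one, mul_zero]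
  rw [Fintype.sum_prod_type]
  simp

/-- The `k`-th matrix acts on product tensors as the twirl on the pair of sites `g k`. -/
def ActsAsTwirl {β : Type*} (g : β → Fin n × Fin n)
    (E : β → Matrix (((Fin n → Fin q) × (Fin n → Fin q)) × ((Fin n → Fin q) × (Fin n → Fin q)))
      (((Fin n → Fin q) × (Fin n → Fin q)) × ((Fin n → Fin q) × (Fin n → Fin q))) ℂ) : Prop :=
  ∀ k τ, E k *ᵥ prodTensor τ =
      twirlCoeff ((q : ℂ) ^ 2) (contract false (τ (g k).1) * contract false (τ (g k).2))
          (contract true (τ (g k).1) * contract true (τ (g k).2)) •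
        prodTensor (Function.update (Function.update τ (g k).1 (pairing false))
          (g k).2 (pairing false)) +
      twirlCoeff ((q : ℂ) ^ 2) (contract true (τ (g k).1) * contract true (τ (g k).2))
          (contract false (τ (g k).1) * contract false (τ (g k).2)) •
        prodTensor (Function.update (Function.update τ (g k).1 (pairing true))
          (g k).2 (pairing true))

variable {β : Type*} {g : β → Fin n × Fin n}
  {E : β → Matrix (((Fin n → Fin q) × (Fin n → Fin q)) × ((Fin n → Fin q) × (Fin n → Fin q)))
      (((Fin n → Fin q) × (Fin n → Fin q)) × ((Fin n → Fin q) × (Fin n → Fin q))) ℂ}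

theorem reverse_prod_cons_mulVec (k : β) (ks : List β)
    (v : ((Fin n → Fin q) × (Fin n → Fin q)) × ((Fin n → Fin q) × (Fin n → Fin q)) → ℂ) :
    ((k :: ks).map E).reverse.prod *ᵥ v = (ks.map E).reverse.prod *ᵥ (E k *ᵥ v) := by
  simp [Matrix.mulVec_mulVec]

/-- At a site which is acted on by some gate, only the two contractions of the local tensor
matter. -/
theorem ActsAsTwirl.mulVec_congr (hE : ActsAsTwirl g E) (ks : List β) {i : Fin n}
    (hi : ∃ k ∈ ks, i = (g k).1 ∨ i = (g k).2)
    {f f' : (Fin q × Fin q) × (Fin q × Fin q) → ℂ} (hf : ∀ s, contract s f = contract s f')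
    (τ : Fin n → (Fin q × Fin q) × (Fin q × Fin q) → ℂ) :
    (ks.map E).reverse.prod *ᵥ prodTensor (Function.update τ i f) =
      (ks.map E).reverse.prod *ᵥ prodTensor (Function.update τ i f') := by
  induction ks generalizing τ with
  | nil => simp at hi
  | cons k ks ih =>
    rw [reverse_prod_cons_mulVec, reverse_prod_cons_mulVec, hE k, hE k]
    have hc : ∀ s j, contract s (Function.update τ i f j) =
        contract s (Function.update τ i f' j) := by
      intro s j
      by_cases hj : j = i
      · subst hj
        simpa using hf s
      · simp [hj]
    simp only [hc]
    by_cases hk : i = (g k).1 ∨ i = (g k).2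
    · have hu : ∀ s : Bool, ∀ f : (Fin q × Fin q) × (Fin q × Fin q) → ℂ,
          Function.update (Function.update (Function.update τ i f) (g k).1 (pairing s))
            (g k).2 (pairing s) =
          Function.update (Function.update τ (g k).1 (pairing s)) (g k).2 (pairing s) := by
        intro s f
        ext1 j
        simp only [Function.update_apply]
        split_ifs <;> simp_all
      simp only [hu]
    -- A gate away from `i` carries the local tensor along unchanged, to the later gate that touches
    -- `i`.
    · have hu : ∀ s : Bool, ∀ f : (Fin q × Fin q) × (Fin q × Fin q) → ℂ,
          Function.update (Function.update (Function.update τ i f) (g k).1 (pairing s))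
            (g k).2 (pairing s) =
          Function.update (Function.update (Function.update τ (g k).1 (pairing s))
            (g k).2 (pairing s)) i f := by
        intro s f
        rw [not_or] at hk
        rw [Function.update_comm hk.1, Function.update_comm hk.2]
      have hi' : ∃ k ∈ ks, i = (g k).1 ∨ i = (g k).2 := by
        obtain ⟨k', hk', h⟩ := hi
        rcases List.mem_cons.mp hk' with rfl | hmem
        · exact absurd h hk
        · exact ⟨k', hmem, h⟩
      simp only [hu, Matrix.mulVec_add, Matrix.mulVec_smul, ih hi']

/-- If every site is acted on, only the contractions of the local tensors matter. -/
theorem ActsAsTwirl.mulVec_congr_all (hE : ActsAsTwirl g E) (ks : List β)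
    (hks : ∀ i, ∃ k ∈ ks, i = (g k).1 ∨ i = (g k).2)
    {τ τ' : Fin n → (Fin q × Fin q) × (Fin q × Fin q) → ℂ}
    (hτ : ∀ s i, contract s (τ i) = contract s (τ' i)) :
    (ks.map E).reverse.prod *ᵥ prodTensor τ = (ks.map E).reverse.prod *ᵥ prodTensor τ' := by
  have h : ∀ S : Finset (Fin n), (ks.map E).reverse.prod *ᵥ prodTensor (S.piecewise τ' τ) =
      (ks.map E).reverse.prod *ᵥ prodTensor τ := by
    intro S
    induction S using Finset.induction_on with
    | empty => simp
    | insert i S hi ih =>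
      rw [← ih, Finset.piecewise_insert,
        hE.mulVec_congr ks (hks i) (fun s => (hτ s i).symm)]
      congr 2
      rw [Function.update_eq_self_iff, Finset.piecewise_eq_of_notMem _ _ _ hi]
  simpa using (h Finset.univ).symm

/-- The sequence of averaged gates acts on identity/swap configurations by the domain-wall
recursion. -/
theorem ActsAsTwirl.dotProduct_pairing_eq_backward (hq : 2 ≤ q) (hE : ActsAsTwirl g E)
    {ks : List β} (hks : ∀ k ∈ ks, (g k).1 ≠ (g k).2)
    (ρ : ((Fin n → Fin q) × (Fin n → Fin q)) × ((Fin n → Fin q) × (Fin n → Fin q)) → ℂ)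
    {h : (Fin n → Bool) → ℝ} (hρ : ∀ γ, ρ ⬝ᵥ prodTensor (fun i => pairing (γ i)) = h γ)
    (γ : Fin n → Bool) :
    ρ ⬝ᵥ ((ks.map E).reverse.prod *ᵥ prodTensor fun i => pairing (γ i)) =
      backward ((q : ℝ) / ((q : ℝ) ^ 2 + 1)) (ks.map g) h γ := by
  induction ks generalizing γ with
  | nil => simpa [backward] using hρ γ
  | cons k ks ih =>
    have hne := hks k (List.mem_cons_self ..)
    replace ih := ih fun k' hk' => hks k' (List.mem_cons_of_mem _ hk')
    have hq0 : (q : ℂ) ≠ 0 := by exact_mod_cast (by omega : q ≠ 0)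
    have hq2 : (q : ℂ) ^ 2 - 1 ≠ 0 := by
      rw [sub_ne_zero]
      exact_mod_cast (Nat.one_lt_pow two_ne_zero (by omega : 1 < q)).ne'
    have hq3 : (q : ℂ) ^ 2 + 1 ≠ 0 := by exact_mod_cast (by omega : q ^ 2 + 1 ≠ 0)
    have hq4 : (q : ℂ) ^ 4 - 1 ≠ 0 := by
      have : (q : ℂ) ^ 4 - 1 = ((q : ℂ) ^ 2 - 1) * ((q : ℂ) ^ 2 + 1) := by ring
      rw [this]
      exact mul_ne_zero hq2 hq3
    have hft := contract_pairing_of_ne (ι := Fin q) (show false ≠ true by decide)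
    have htf := contract_pairing_of_ne (ι := Fin q) (show true ≠ false by decide)
    have hself := contract_pairing_self (ι := Fin q)
    rw [Fintype.card_fin] at hft htf hself
    -- A pairing has contraction $q^2$ with itself and $q$ with the other one. On two equal sites
    -- the twirl coefficients are $1$ and $0$; on unequal sites both are
    -- $q^3(q^2-1)/(q^2(q^4-1))=\kappa$.
    have hone : twirlCoeff ((q : ℂ) ^ 2) ((q : ℂ) ^ 2 * (q : ℂ) ^ 2) (q * q) = 1 := by
      rw [twirlCoeff]
      field_simp
    have hzero : twirlCoeff ((q : ℂ) ^ 2) (q * q) ((q : ℂ) ^ 2 * (q : ℂ) ^ 2) = 0 := by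
      rw [twirlCoeff]
      ring
    have hcross : twirlCoeff ((q : ℂ) ^ 2) ((q : ℂ) ^ 2 * q) (q * (q : ℂ) ^ 2) =
        q / ((q : ℂ) ^ 2 + 1) := by
      rw [twirlCoeff]
      field_simp
      ring
    have hcross' : twirlCoeff ((q : ℂ) ^ 2) (q * (q : ℂ) ^ 2) ((q : ℂ) ^ 2 * q) =
        q / ((q : ℂ) ^ 2 + 1) := by
      rw [← hcross, mul_comm (q : ℂ) ((q : ℂ) ^ 2)]
    have hset : ∀ s, Function.update (Function.update
        (fun i => (pairing (γ i) : (Fin q × Fin q) × (Fin q × Fin q) → ℂ)) (g k).1 (pairing s))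
          (g k).2 (pairing s) = fun i => pairing (setBoth γ (g k) s i) := by
      intro s
      ext1 i
      simp only [setBoth, Function.update_apply]
      split_ifs <;> rfl
    have hsame : ∀ s, γ (g k).1 = s → γ (g k).2 = s → setBoth γ (g k) s = γ := by
      rintro s h1 h2
      rw [setBoth, ← h1, Function.update_eq_self, h1, ← h2, Function.update_eq_self]
    rw [reverse_prod_cons_mulVec, hE k]
    simp only [hset, Matrix.mulVec_add, Matrix.mulVec_smul, dotProduct_add, dotProduct_smul, ih,
      List.map_cons, backward, smul_eq_mul]
    cases h1 : γ (g k).1 <;> cases h2 : γ (g k).2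
    · simp [hself, htf, hone, hzero, hsame _ h1 h2]
    · simp [hself, htf, hft, hcross, hcross']
      ring
    · simp [hself, htf, hft, hcross, hcross']
      ring
    · simp [hself, hft, hone, hzero, hsame _ h1 h2]

end Sequence

/-! ### Parameterized gates -/

section ParamGates

variable {q p : ℕ}

theorem exp_smul_mem_unitaryGroup {ι : Type*} [Fintype ι] [DecidableEq ι] {A : Matrix ι ι ℂ}
    (hA : A.IsHermitian) (t : ℝ) :
    NormedSpace.exp ((-((t : ℂ) * Complex.I)) • A) ∈ Matrix.unitaryGroup ι ℂ := by
  have h : star ((-((t : ℂ) * Complex.I)) • A) = -((-((t : ℂ) * Complex.I)) • A) := by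
    rw [star_smul, Matrix.star_eq_conjTranspose, hA.eq]
    simp
  have hc : Commute ((-((t : ℂ) * Complex.I)) • A) (-((-((t : ℂ) * Complex.I)) • A)) :=
    (Commute.refl _).neg_right
  rw [Matrix.mem_unitaryGroup_iff, Matrix.star_eq_conjTranspose, ← Matrix.exp_conjTranspose,
    ← Matrix.star_eq_conjTranspose, h, ← Matrix.exp_add_of_commute _ _ hc, add_neg_cancel,
    NormedSpace.exp_zero]

theorem ParamGate.toOp_mem_unitaryGroup (G : ParamGate q p) (θ : Fin p → ℝ) :
    G.toOp θ ∈ Matrix.unitaryGroup (Fin q × Fin q) ℂ :=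
  mul_mem (mul_mem G.Wl.2 (exp_smul_mem_unitaryGroup G.isHermitian _)) G.Wr.2

theorem paramProd_mem_unitaryGroup (L : List (ParamGate q p)) (θ : Fin p → ℝ) :
    paramProd L θ ∈ Matrix.unitaryGroup (Fin q × Fin q) ℂ := by
  refine list_prod_mem fun W hW => ?_
  obtain ⟨G, -, rfl⟩ := List.mem_map.mp (List.mem_reverse.mp hW)
  exact G.toOp_mem_unitaryGroup θ

open scoped Matrix.Norms.Operator in
theorem continuous_matrix_exp {ι : Type*} [Fintype ι] [DecidableEq ι] :
    Continuous (NormedSpace.exp : Matrix ι ι ℂ → Matrix ι ι ℂ) :=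
  NormedSpace.exp_continuous

theorem ParamGate.continuous_toOp (G : ParamGate q p) : Continuous G.toOp := by
  have h : Continuous fun θ : Fin p → ℝ => (-((θ G.param : ℂ) * Complex.I)) • G.A := by
    fun_prop
  exact (continuous_const.matrix_mul (continuous_matrix_exp.comp h)).matrix_mul continuous_const

theorem continuous_paramProd (L : List (ParamGate q p)) : Continuous (paramProd L) := by
  unfold paramProd
  simp only [← List.map_reverse]
  exact continuous_list_prod _ fun G _ => G.continuous_toOp

end ParamGates

/-! ### The circuit -/

/-- Second countability makes continuous functions of several gates measurable for the product
σ-algebra. -/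
instance (q : ℕ) : SecondCountableTopology (U2 q) := by
  have : SecondCountableTopology (TwoQuditOp q) :=
    inferInstanceAs (SecondCountableTopology (Fin q × Fin q → Fin q × Fin q → ℂ))
  exact TopologicalSpace.Subtype.secondCountableTopology _

section Circuit

variable {n q p : ℕ}

theorem VarCircuit.continuous_expVal [NeZero q] (C : VarCircuit n q p) (M : QuditOp n q) :
    Continuous fun v : (Fin C.m → U2 q) × (Fin p → ℝ) => C.expVal v.1 v.2 M := by
  have hU : Continuous fun v : (Fin C.m → U2 q) × (Fin p → ℝ) => C.U v.1 v.2 := by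
    unfold VarCircuit.U
    simp only [List.ofFn_eq_map, ← List.map_reverse]
    refine continuous_list_prod _ fun k _ => continuous_embed _ _ ?_
    exact (((continuous_paramProd _).comp continuous_snd).matrix_mul (continuous_U2_val.comp
      ((continuous_apply k).comp continuous_fst))).matrix_mul
        ((continuous_paramProd _).comp continuous_snd)
  exact ((hU.matrix_conjTranspose.matrix_mul continuous_const).matrix_mul hU).matrix_elem _ _

/-- The two-copy tensor of `M ⊗ M†` on a single site. -/
def obsTensor (M : Matrix (Fin q) (Fin q) ℂ) (p : (Fin q × Fin q) × (Fin q × Fin q)) : ℂ :=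
  M p.2.1 p.1.1 * starRingEnd ℂ (M p.1.2 p.2.2)

/-- The two-copy tensor of the state `|0⟩` on a single site. -/
def zeroTensor [NeZero q] : (Fin q × Fin q) × (Fin q × Fin q) → ℂ := Pi.single ((0, 0), (0, 0)) 1

theorem contract_obsTensor_true (M : Matrix (Fin q) (Fin q) ℂ) :
    contract true (obsTensor M) = (M.conjTranspose * M).trace := by
  simp only [contract, obsTensor, copyPerm, if_true, Prod.swap, Fintype.sum_prod_type,
    Matrix.trace, Matrix.diag, Matrix.mul_apply, Matrix.conjTranspose_apply]
  exact Finset.sum_congr rfl fun a _ => Finset.sum_congr rfl fun b _ => mul_comm _ _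

theorem contract_obsTensor_false (M : Matrix (Fin q) (Fin q) ℂ) :
    contract false (obsTensor M) = M.trace * starRingEnd ℂ M.trace := by
  simp only [contract, obsTensor, copyPerm, Bool.false_eq_true, if_false, Fintype.sum_prod_type,
    Matrix.trace, Matrix.diag, map_sum, Finset.sum_mul_sum]

theorem contract_zeroTensor [NeZero q] (s : Bool) :
    contract s (zeroTensor : (Fin q × Fin q) × (Fin q × Fin q) → ℂ) = 1 := by
  have h : ∀ u : Fin q × Fin q, (zeroTensor (q := q)) (u, copyPerm s u) =
      if u = (0, 0) then 1 else 0 := by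
    rintro ⟨a, b⟩
    simp only [zeroTensor, Pi.single_apply]
    congr 1
    cases s
    · simp [copyPerm]
    · simp [copyPerm]
      tauto
  simp [contract, h]

theorem prodTensor_zeroTensor [NeZero q] :
    prodTensor (fun _ : Fin n => zeroTensor (q := q)) =
      Pi.single ((fun _ => 0, fun _ => 0), (fun _ => 0, fun _ => 0)) 1 := by
  ext ⟨⟨a, b⟩, ⟨c, e⟩⟩
  simp only [prodTensor, zeroTensor, Pi.single_apply, siteIndex, Prod.mk.injEq,
    Finset.prod_ite_zero, Finset.prod_const_one, funext_iff]
  congr 1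
  simp [forall_and]

/-- Expand the expectation times its conjugate: both are sums over entries of the $|0^n\rangle$
column of $U$, so the product is a linear functional of one column of the two-copy tensor. -/
theorem norm_sq_eq_dotProduct [NeZero q] (M : Fin n → Matrix (Fin q) (Fin q) ℂ)
    (U : QuditOp n q) :
    ((‖(U.conjTranspose * (Matrix.of fun a b : Fin n → Fin q => ∏ i, M i (a i) (b i)) * U)
        (fun _ => 0) (fun _ => 0)‖ ^ 2 : ℝ) : ℂ) =
      prodTensor (fun i => obsTensor (M i)) ⬝ᵥ
        (twoCopy U *ᵥ prodTensor fun _ => zeroTensor) := by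
  have hobs : ∀ a b c e : Fin n → Fin q, prodTensor (fun i => obsTensor (M i)) ((a, b), (c, e)) =
      (∏ i, M i (c i) (a i)) * starRingEnd ℂ (∏ i, M i (b i) (e i)) := by
    intro a b c e
    simp [prodTensor, obsTensor, siteIndex, Finset.prod_mul_distrib]
  have hexp : (U.conjTranspose * (Matrix.of fun a b : Fin n → Fin q => ∏ i, M i (a i) (b i)) * U)
        (fun _ => 0) (fun _ => 0) = ∑ a, ∑ c, (∏ i, M i (c i) (a i)) *
          (U a (fun _ => 0) * starRingEnd ℂ (U c fun _ => 0)) := by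
    simp only [Matrix.mul_apply, Matrix.conjTranspose_apply, Matrix.of_apply, Finset.sum_mul]
    refine Finset.sum_congr rfl fun a _ => Finset.sum_congr rfl fun c _ => ?_
    rw [starRingEnd_apply]
    ring
  rw [Complex.ofReal_pow, ← Complex.mul_conj', hexp, prodTensor_zeroTensor,
    Matrix.mulVec_single_one]
  simp only [dotProduct, Matrix.col_apply, Fintype.sum_prod_type
    (α₁ := (Fin n → Fin q) × (Fin n → Fin q)), Fintype.sum_prod_type (α₁ := Fin n → Fin q), hobs,
    twoCopy_apply, map_sum, map_mul, Complex.conj_conj]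
  simp only [Finset.sum_mul_sum]
  refine Finset.sum_congr rfl fun a _ => ?_
  refine Finset.sum_comm.trans (Eq.trans (Finset.sum_congr rfl fun c _ => ?_)
    Finset.sum_comm.symm)
  refine Finset.sum_comm.trans (Finset.sum_congr rfl fun b _ => Finset.sum_congr rfl fun e _ => ?_)
  ring

theorem twoCopy_reverse_prod {ι β : Type*} [Fintype ι] [DecidableEq ι] (f : β → Matrix ι ι ℂ)
    (ks : List β) :
    twoCopy (ks.map f).reverse.prod = (ks.map fun k => twoCopy (f k)).reverse.prod := by
  induction ks with
  | nil => simp [twoCopy_one]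
  | cons k ks ih => simp [twoCopy_mul, ← ih]

/-- The bound on `g_x` at fixed values of the parameters. -/
theorem VarCircuit.integral_expVal_le [NeZero q] (hq : 2 ≤ q) (C : VarCircuit n q p)
    {μ : Fin C.m → Measure (U2 q)} {M : Fin (q ^ 2) → Matrix (Fin q) (Fin q) ℂ}
    {x : Fin n → Fin (q ^ 2)} (hμ : ∀ k, IsTwoDesign (μ k)) (hM : IsOperatorBasis M) {r : ℕ}
    (hr : C.IsRegularlyConnected r) (hx : x ≠ 0) (θ : Fin p → ℝ) :
    ∫ V, ‖C.expVal V θ (tensorOp M x)‖ ^ 2 ∂(Measure.pi μ) ≤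
      (2 * (q : ℝ) / (q + 1)) ^ n * (2 * (q : ℝ) / ((q : ℝ) ^ 2 + 1)) ^ (C.d / r) *
        ((q : ℝ) ^ hammingNorm x)⁻¹ + ((q : ℝ) ^ n + 1)⁻¹ := by
  have := fun k => (hμ k).isProbabilityMeasure
  set g : Fin C.m → Fin n × Fin n := fun k => (C.fst k, C.snd k) with hg
  set F : Fin C.m → U2 q → _ := fun k V => twoCopy (embed (n := n) (C.fst k) (C.snd k)
    (paramProd (C.post k) θ * V.1 * paramProd (C.pre k) θ)) with hF
  set E := fun k => meanMatrix (μ k) (F k) with hEdef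
  have hE : ActsAsTwirl g E := fun k τ =>
    (hμ k).meanMatrix_embed_mulVec hq (paramProd_mem_unitaryGroup _ θ)
      (paramProd_mem_unitaryGroup _ θ) (C.fst_ne_snd k) τ
  have hFc : ∀ k, Continuous (F k) := fun k => continuous_twoCopy (continuous_embed _ _
    ((continuous_const.matrix_mul continuous_U2_val).matrix_mul continuous_const))
  set ks := List.finRange C.m with hks
  have hx' : (Finset.univ.filter fun i => x i ≠ 0).Nonempty := by
    obtain ⟨i, hi⟩ := Function.ne_iff.mp hx
    exact ⟨i, by simpa using hi⟩
  have hn : 0 < n := by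
    obtain ⟨i, -⟩ := hx'
    exact i.pos
  set h : (Fin n → Bool) → ℝ := fun γ => ∏ i, if γ i then (q : ℝ) else
    if i ∈ (Finset.univ.filter fun i => x i ≠ 0) then 0 else (q : ℝ) ^ 2 with hh
  have hρ : ∀ γ : Fin n → Bool, prodTensor (fun i => obsTensor (M (x i))) ⬝ᵥ
      prodTensor (fun i => pairing (γ i)) = h γ := by
    intro γ
    rw [prodTensor_dotProduct, hh, Complex.ofReal_prod]
    refine Finset.prod_congr rfl fun i _ => ?_
    rw [dotProduct_pairing]
    cases γ i
    · rw [contract_obsTensor_false]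
      by_cases hxi : x i = 0
      · simp [hxi, hM.1, sq]
      · have h0 : (M (x i)).trace = 0 := by
          simpa [hM.1, Ne.symm hxi] using hM.2 0 (x i)
        simp [hxi, h0]
    · rw [contract_obsTensor_true, hM.2]
      simp
  have hmean : meanMatrix (Measure.pi μ) (fun V => twoCopy (C.U V θ)) =
      (ks.map E).reverse.prod := by
    have := meanMatrix_pi_prod C.m μ F hFc
    simp only [List.ofFn_eq_map] at this
    rw [hEdef, ← this]
    congr 1
    ext1 V
    rw [VarCircuit.U, List.ofFn_eq_map, twoCopy_reverse_prod]
    rfl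
  have hUc : Continuous fun V => twoCopy (C.U V θ) := by
    refine continuous_twoCopy ?_
    unfold VarCircuit.U
    simp only [List.ofFn_eq_map, ← List.map_reverse]
    refine continuous_list_prod _ fun k _ => continuous_embed _ _ ?_
    exact (continuous_const.matrix_mul (continuous_U2_val.comp (continuous_apply k))).matrix_mul
      continuous_const
  have hint : ((∫ V, ‖C.expVal V θ (tensorOp M x)‖ ^ 2 ∂(Measure.pi μ) : ℝ) : ℂ) =
      prodTensor (fun i => obsTensor (M (x i))) ⬝ᵥ
        ((ks.map E).reverse.prod *ᵥ prodTensor fun _ => zeroTensor) := by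
    rw [← integral_complex_ofReal, ← hmean]
    simp only [VarCircuit.expVal, tensorOp, norm_sq_eq_dotProduct]
    simp only [dotProduct, meanMatrix_mulVec _ hUc]
    rw [integral_finsetSum]
    · exact Finset.sum_congr rfl fun a _ => integral_const_mul _ _
    · intro a _
      refine integrable_of_continuous_of_compactSpace _ (continuous_const.mul ?_)
      simp only [Matrix.mulVec, dotProduct]
      exact continuous_finsetSum _ fun d _ => (hUc.matrix_elem _ _).mul continuous_const
  -- Both contractions of $|0\rangle$ equal $1$. Identity plus swap has both contractions $q^2+q$,
  -- so $c$ times it can stand in for $|0\rangle$ at every site.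
  set c : ℂ := ((q : ℂ) * (q + 1))⁻¹ with hc
  have hinit : (ks.map E).reverse.prod *ᵥ prodTensor (fun _ => zeroTensor) =
      c ^ n • ∑ γ : Fin n → Bool,
        (ks.map E).reverse.prod *ᵥ prodTensor (fun i => pairing (γ i)) := by
    rw [hE.mulVec_congr_all ks (τ' := fun _ => c • ∑ s, pairing s)]
    · rw [← Matrix.mulVec_sum, ← Matrix.mulVec_smul]
      congr 1
      ext p
      have hp := Finset.prod_univ_sum (fun _ : Fin n => (Finset.univ : Finset Bool))
        (fun i s => pairing s (siteIndex p i))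
      rw [Fintype.piFinset_univ] at hp
      simp only [prodTensor, Pi.smul_apply, Finset.sum_apply, smul_eq_mul,
        Finset.prod_mul_distrib, hp, Finset.prod_const, Finset.card_univ, Fintype.card_fin]
    · intro i
      obtain ⟨k, hk⟩ := C.covers i
      exact ⟨k, List.mem_finRange k, hk⟩
    · intro s i
      have hq0 : (q : ℂ) ≠ 0 := by exact_mod_cast (by omega : q ≠ 0)
      have hq1 : (q : ℂ) + 1 ≠ 0 := by exact_mod_cast (by omega : q + 1 ≠ 0)
      rw [contract_zeroTensor, contract_smul, Fintype.sum_bool, contract_add]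
      cases s
      · rw [contract_pairing_self, contract_pairing_of_ne (by decide), hc, Fintype.card_fin]
        field_simp
        ring
      · rw [contract_pairing_self, contract_pairing_of_ne (by decide), hc, Fintype.card_fin]
        field_simp
  have hne : ∀ k ∈ ks, (g k).1 ≠ (g k).2 := fun k _ => C.fst_ne_snd k
  have hval : ∫ V, ‖C.expVal V θ (tensorOp M x)‖ ^ 2 ∂(Measure.pi μ) =
      (((q : ℝ) * (q + 1))⁻¹) ^ n * ∑ γ : Fin n → Bool,
        backward ((q : ℝ) / ((q : ℝ) ^ 2 + 1)) (ks.map g) h γ := by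
    rw [← Complex.ofReal_inj, hint, hinit, dotProduct_smul, dotProduct_sum]
    simp only [hE.dotProduct_pairing_eq_backward hq hne _ hρ]
    simp [hc]
  have hq1 : (1 : ℝ) ≤ q := by exact_mod_cast (by omega : 1 ≤ q)
  rw [hval]
  refine sum_backward_le hq1 hn (ks.map g) ?_ (fun γ => ?_) hx'
  · intro e he
    obtain ⟨k, hk, rfl⟩ := List.mem_map.mp he
    exact hne k hk
  · rw [mul_div_assoc]
    refine backward_nonconst_le g (fun k => (C.layer k : ℕ)) r (by positivity) ?_ (C.d / r) 0 ks
      ?_ (fun j hj γ h0 h1 => ?_) γ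
    · rw [← mul_div_assoc, div_le_one (by positivity)]
      nlinarith [sq_nonneg ((q : ℝ) - 1)]
    · exact (List.pairwise_le_finRange C.m).imp fun hab => C.layer_mono hab
    -- The cut is the set of swap sites, nonempty and proper as `γ` is not constant; the $\lfloor
    -- d/r\rfloor$ disjoint windows start at layers $jr$.
    · obtain ⟨k, hlo, hhi, hcr⟩ := hr (j * r) (by
        calc j * r + r = (j + 1) * r := by ring
          _ ≤ (C.d / r) * r := Nat.mul_le_mul_right r hj
          _ ≤ C.d := Nat.div_mul_le_self _ _) (Finset.univ.filter fun i => γ i = true)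
        (by
          obtain ⟨i, hi⟩ := Function.ne_iff.mp h0
          exact ⟨i, by simpa using hi⟩)
        (fun heq => h1 (funext fun i => by
          have := heq ▸ Finset.mem_univ i
          simpa using this))
      refine ⟨k, List.mem_finRange k, by simpa using hlo, by simpa using hhi, ?_⟩
      simp only [Architecture.Crosses, Finset.mem_filter, Finset.mem_univ, true_and] at hcr
      simp only [hg]
      intro heq
      rw [heq] at hcr
      tauto

/-- The bound on `g_x` for regularly connected circuits. -/
theorem VarCircuit.g_le [NeZero q] (hq : 2 ≤ q) (C : VarCircuit n q p)
    {μ : Fin C.m → Measure (U2 q)} {M : Fin (q ^ 2) → Matrix (Fin q) (Fin q) ℂ}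
    {x : Fin n → Fin (q ^ 2)} (hμ : ∀ k, IsTwoDesign (μ k)) (hM : IsOperatorBasis M) {r : ℕ}
    (hr : C.IsRegularlyConnected r) (hx : x ≠ 0) :
    C.g μ M x ≤
      (2 * (q : ℝ) / (q + 1)) ^ n * (2 * (q : ℝ) / ((q : ℝ) ^ 2 + 1)) ^ (C.d / r) *
        ((q : ℝ) ^ hammingNorm x)⁻¹ + ((q : ℝ) ^ n + 1)⁻¹ := by
  have := fun k => (hμ k).isProbabilityMeasure
  set b := (2 * (q : ℝ) / (q + 1)) ^ n * (2 * (q : ℝ) / ((q : ℝ) ^ 2 + 1)) ^ (C.d / r) *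
        ((q : ℝ) ^ hammingNorm x)⁻¹ + ((q : ℝ) ^ n + 1)⁻¹
  set K := Set.Icc (0 : Fin p → ℝ) (fun _ => 2 * Real.pi) with hK
  have hKc : IsCompact K := isCompact_Icc
  have hcont : Continuous fun v : (Fin C.m → U2 q) × (Fin p → ℝ) =>
      ‖C.expVal v.1 v.2 (tensorOp M x)‖ ^ 2 := (C.continuous_expVal _).norm.pow 2
  have hint : Integrable (fun v : (Fin C.m → U2 q) × (Fin p → ℝ) =>
      ‖C.expVal v.1 v.2 (tensorOp M x)‖ ^ 2) ((Measure.pi μ).prod (volume.restrict K)) := by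
    have h := hcont.continuousOn.integrableOn_compact (μ := (Measure.pi μ).prod volume)
      (isCompact_univ.prod hKc)
    rwa [IntegrableOn, ← Measure.prod_restrict, Measure.restrict_univ] at h
  have hvol : volume.real K ≠ 0 := by
    rw [hK, Measure.real, Real.volume_Icc_pi, ENNReal.toReal_prod]
    refine Finset.prod_ne_zero_iff.mpr fun i _ => ?_
    simp [Real.pi_pos.le, Real.pi_ne_zero]
  unfold VarCircuit.g
  simp only [setAverage_eq, smul_eq_mul]
  -- With the gate average innermost, the bound at fixed $\theta$ applies pointwise, and the average
  -- of a constant is that constant.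
  rw [integral_const_mul, integral_integral_swap hint]
  have hle : ∫ θ in K, ∫ V, ‖C.expVal V θ (tensorOp M x)‖ ^ 2 ∂(Measure.pi μ) ≤
      volume.real K * b := by
    calc _ ≤ ∫ _θ in K, b := by
          have hfin : IsFiniteMeasure (volume.restrict K) := ⟨by
            simpa using hKc.measure_lt_top⟩
          exact integral_mono hint.integral_prod_right (integrable_const b)
            fun θ => C.integral_expVal_le hq hμ hM hr hx θ
      _ = _ := by simp
  calc _ ≤ (volume.real K)⁻¹ * (volume.real K * b) :=
        mul_le_mul_of_nonneg_left hle (inv_nonneg.mpr measureReal_nonneg)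
    _ = b := by field_simp

end Circuit

/-! ### Exponential form for deep circuits. -/

/-- A regularly connected architecture on a nonempty set of qudits has positive `r`. -/
theorem Architecture.IsRegularlyConnected.pos {n r : ℕ} (hn : 0 < n) {C : Architecture n}
    (hr : C.IsRegularlyConnected r) : 0 < r := by
  rcases Nat.eq_zero_or_pos r with rfl | h
  · obtain ⟨k, -⟩ := C.covers ⟨0, hn⟩
    obtain ⟨l, h1, h2, -⟩ := hr 0 (Nat.zero_le _) {C.fst k} (Finset.singleton_nonempty _) fun h =>
      C.fst_ne_snd k (Finset.mem_singleton.mp (h ▸ Finset.mem_univ (C.snd k))).symm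
    omega
  · exact h

/-- The deep-circuit form of the bound. -/
theorem rpow_bound {q d r n : ℕ} (hq : 2 ≤ q) (hr : 0 < r) (hn : 0 < n) :
    (2 * (q : ℝ) / (q + 1)) ^ n * (2 * (q : ℝ) / ((q : ℝ) ^ 2 + 1)) ^ (d / r) ≤
      (q : ℝ) ^ (-(1 / 4 * (((d : ℝ) - 5 * (r * n)) / r))) := by
  have hq2 : (2 : ℝ) ≤ q := by exact_mod_cast hq
  have hq0 : (0 : ℝ) < q := by linarith
  have hr0 : (0 : ℝ) < r := by exact_mod_cast hr
  have h1 : 2 * (q : ℝ) / (q + 1) ≤ q := by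
    rw [div_le_iff₀ (by positivity)]
    nlinarith
  -- Taking fourth powers, the claim is $16q^5\le(q^2+1)^4$; the constants below satisfy
  -- $(5/2)^2\cdot 64/25=16$. At $q=2$ the exponent $1/3$ would already fail.
  have h2 : 2 * (q : ℝ) / ((q : ℝ) ^ 2 + 1) ≤ (q : ℝ) ^ (-(1 / 4) : ℝ) := by
    have h4 : ((q : ℝ) ^ (-(1 / 4) : ℝ)) ^ 4 = (q : ℝ)⁻¹ := by
      rw [← Real.rpow_natCast, ← Real.rpow_mul hq0.le, ← Real.rpow_neg_one]
      norm_num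
    refine le_of_pow_le_pow_left₀ four_ne_zero (by positivity) ?_
    rw [h4, div_pow, div_le_iff₀ (by positivity), inv_mul_eq_div, le_div_iff₀ hq0]
    have h5 : 5 / 2 * (q : ℝ) ≤ (q : ℝ) ^ 2 + 1 := by nlinarith
    have h6 : 64 / 25 * (q : ℝ) ^ 3 ≤ ((q : ℝ) ^ 2 + 1) ^ 2 := by
      nlinarith [sq_nonneg ((q : ℝ) * (q - 32 / 25)), sq_nonneg (q : ℝ)]
    calc (2 * (q : ℝ)) ^ 4 * q = (5 / 2 * (q : ℝ)) ^ 2 * (64 / 25 * (q : ℝ) ^ 3) := by ring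
      _ ≤ ((q : ℝ) ^ 2 + 1) ^ 2 * ((q : ℝ) ^ 2 + 1) ^ 2 := by gcongr
      _ = _ := by ring
  have h3 : (d : ℝ) / r < (d / r : ℕ) + 1 := by
    rw [div_lt_iff₀ hr0]
    exact_mod_cast Nat.lt_mul_of_div_lt (Nat.lt_succ_self _) hr
  have hn1 : (1 : ℝ) ≤ n := by exact_mod_cast hn
  calc _ ≤ (q : ℝ) ^ n * ((q : ℝ) ^ (-(1 / 4) : ℝ)) ^ (d / r) :=
        mul_le_mul (pow_le_pow_left₀ (by positivity) h1 n) (pow_le_pow_left₀ (by positivity) h2 _)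
          (by positivity) (by positivity)
    _ = (q : ℝ) ^ ((n : ℝ) + -(1 / 4) * (d / r : ℕ)) := by
        rw [Real.rpow_add hq0, Real.rpow_natCast, Real.rpow_mul hq0.le, Real.rpow_natCast]
    _ ≤ _ := by
        -- Here $n-\frac14\lfloor d/r\rfloor\le n+\frac14-\frac{d}{4r}\le\frac54n-\frac{d}{4r}$: of
        -- the constant $5$, four parts pay for the factor $q^n$ and one for the floor, using
        -- $n\ge1$.
        refine Real.rpow_le_rpow_of_exponent_le (by linarith) ?_
        have : ((d : ℝ) - 5 * (r * n)) / r = d / r - 5 * n := by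
          field_simp
        rw [this]
        linarith

end HEA

end

theorem corollary3 :
    (∀ (n q p r : ℕ) [NeZero q] (_ : 2 ≤ q) (C : HEA.VarCircuit n q p)
        (μ : Fin C.m → MeasureTheory.Measure (HEA.U2 q))
        (M : Fin (q ^ 2) → Matrix (Fin q) (Fin q) ℂ) (x : Fin n → Fin (q ^ 2)),
        (∀ k, HEA.IsTwoDesign (μ k)) → HEA.IsOperatorBasis M →
        C.IsRegularlyConnected r → x ≠ 0 →
        C.g μ M x ≤
          (2 * (q : ℝ) / (q + 1)) ^ n * (2 * (q : ℝ) / ((q : ℝ) ^ 2 + 1)) ^ (C.d / r) *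
              (q : ℝ) ^ (-(hammingNorm x : ℝ)) + ((q : ℝ) ^ n + 1)⁻¹) ∧
    (∃ a b : ℝ, 0 < a ∧ 0 < b ∧
      ∀ (n q p r : ℕ) [NeZero q] (_ : 2 ≤ q) (C : HEA.VarCircuit n q p)
        (μ : Fin C.m → MeasureTheory.Measure (HEA.U2 q))
        (M : Fin (q ^ 2) → Matrix (Fin q) (Fin q) ℂ) (x : Fin n → Fin (q ^ 2)),
        (∀ k, HEA.IsTwoDesign (μ k)) → HEA.IsOperatorBasis M →
        C.IsRegularlyConnected r → x ≠ 0 →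
        a * (r * n) < C.d →
        C.g μ M x ≤
          (q : ℝ) ^ (-(n : ℝ)) +
            (q : ℝ) ^ (-(b * ((C.d - a * (r * n)) / r)) - (hammingNorm x : ℝ))) := by
  refine ⟨?_, 5, 1 / 4, by norm_num, by norm_num, ?_⟩
  · intro n q p r _ hq C μ M x hμ hM hr hx
    rw [Real.rpow_neg (Nat.cast_nonneg q), Real.rpow_natCast]
    exact C.g_le hq hμ hM hr hx
  · intro n q p r _ hq C μ M x hμ hM hr hx _
    have hq0 : (0 : ℝ) < q := by exact_mod_cast (by omega : 0 < q)
    obtain ⟨i, -⟩ := Function.ne_iff.mp hx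
    have hn : 0 < n := i.pos
    refine (C.g_le hq hμ hM hr hx).trans ?_
    rw [add_comm, Real.rpow_sub hq0, Real.rpow_neg hq0.le, Real.rpow_natCast, Real.rpow_natCast,
      div_eq_mul_inv]
    refine add_le_add (inv_anti₀ (by positivity) (by linarith)) ?_
    exact mul_le_mul_of_nonneg_right (HEA.rpow_bound hq (hr.pos hn) hn) (by positivity)
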